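/- **Theorem.** Let $(\Omega,\mathcal F,\mathbb P)$ be a probability space carrying a Brownian motion $W$, two Poisson processes $N^+,N^-$ of intensity $\lambda$ (every path starting at $0$, nondecreasing, right-continuous, with jumps of size one), and two i.i.d. sequences $(\zeta^+_i)_{i\in\mathbb N}$, $(\zeta^-_i)_{i\in\mathbb N}$ of real random variables with $\mathbb E[\zeta^\pm_i]=\eta$ and $\mathbb E[|\zeta^\pm_i|^2]<\infty$, such that $W,N^+,N^-,(\zeta^+_i)_i,(\zeta^-_i)_i$ are independent. Put $\mathcal F_t=\sigma(W_s,N^+_s,N^-_s,\zeta^+_{N^+_s},\zeta^-_{N^-_s}; s\le t)$ and $m=\tfrac12\big(\mathbb E[(\zeta^+_1)^2]+\mathbb E[(\zeta^-_1)^2]\big)$; in particular $m=\eta^2$ if the sizes are deterministic. Let $k>0$, $b\ge 0$, $\phi>0$, $\alpha,r,S_0\in\mathbb R$, and $$\tilde\varphi=\sqrt{\phi/k},\qquad \xi=\frac{\alpha-\frac12 b+k\tilde\varphi}{\alpha-\frac12 b-k\tilde\varphi},$$ and assume $\xi>1$ (equivalently $\alpha>\tfrac12 b+\sqrt{k\phi}$).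 Let $0\le t\le T$ and $q\in\mathbb R$. Let $\mathcal A[t,T]$ be the set of $(\mathcal F_s)$-progressively measurable $\nu:[t,T]\times\Omega\to\mathbb R$ with $\mathbb E\int_t^T|\nu_s|^2\,ds<\infty$. For $\nu\in\mathcal A[t,T]$ let $$Q^\nu_s=q-\int_t^s\nu_u\,du+\sum_{i=N^+_t+1}^{N^+_s}\zeta^+_i-\sum_{i=N^-_t+1}^{N^-_s}\zeta^-_i,\qquad s\in[t,T],$$ $$F(q,\nu)=-k\nu^2-b\nu q-\phi q^2+2\lambda\eta rS_0,\qquad G(q)=-\alpha q^2,$$ $$v(t,q)=\sup_{\nu\in\mathcal A[t,T]}\mathbb E\Big[\int_t^TF(Q^\nu_s,\nu_s)\,ds+G(Q^\nu_T)\Big].$$ Then, for every $\nu\in\mathcal A[t,T]$, $F(Q^\nu,\nu)$ is integrable on $[t,T]\times\Omega$ and $G(Q^\nu_T)$ is integrable on $\Omega$. Moreover $v(t,q)=u(t,q):=h_0(t)+h_2(t)q^2$, where $$h_2(t)=k\tilde\varphi\,\frac{1+\xi e^{2\tilde\varphi(T-t)}}{1-\xi e^{2\tilde\varphi(T-t)}}-\frac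 b2,$$ $$h_0(t)=2\lambda m k\ln\frac{\xi-1}{\xi e^{\tilde\varphi(T-t)}-e^{-\tilde\varphi(T-t)}}+(\lambda m b-2r\lambda\eta S_0)(t-T),$$ and the supremum is attained: there is $\nu\in\mathcal A[t,T]$ with $\nu_s=\nu^*(s,Q^\nu_s)$ for all $s\in[t,T]$, everywhere on $\Omega$, whose expected reward equals $v(t,q)$, where $$\nu^*(s,q)=\tilde\varphi\,\frac{\xi e^{2\tilde\varphi(T-s)}+1}{\xi e^{2\tilde\varphi(T-s)}-1}\,q.$$ -/

import Mathlib

open MeasureTheory ProbabilityTheory Set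
open scoped NNReal ENNReal

noncomputable section

namespace Liquidation

variable {Ω : Type*} [mΩ : MeasurableSpace Ω]

/-- `N` is a (homogeneous) Poisson process with intensity `lam`: it starts at `0`, its paths are
nondecreasing, right-continuous, with jumps of size one, and its increments are independent and
Poisson distributed. -/
structure IsPoissonProcess (N : ℝ≥0 → Ω → ℕ) (lam : ℝ≥0) (μ : Measure Ω) : Prop where
  measurable : ∀ t, Measurable (N t)
  zero : ∀ ω, N 0 ω = 0
  mono : ∀ ω, Monotone fun t => N t ω
  right_continuous : ∀ ω t, ContinuousWithinAt (fun s => N s ω) (Ici t) t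
  unit_jumps : ∀ ω t, 0 < t → ∃ s < t, N t ω ≤ N s ω + 1
  law_increment : ∀ s h : ℝ≥0,
    HasLaw (fun ω => N (s + h) ω - N s ω) (poissonMeasure (lam * h)) μ
  indep_increments : HasIndepIncrements (fun t ω => (N t ω : ℝ)) μ

/-- Parameters of the model: the liquidation intensity `lam`, the mean liquidation size `eta`, the
inverse leverage `r`, the initial mid-price `S0`, the temporary and permanent price impact
coefficients `k` and `b`, and the running and terminal inventory penalties `phi` and `alpha`. -/
structure Params where
  lam : ℝ≥0
  eta : ℝ
  r : ℝ
  S0 : ℝ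
  k : ℝ
  b : ℝ
  phi : ℝ
  alpha : ℝ

/-- The random inputs of the model: a Brownian motion `W`, two Poisson processes `Np`, `Nm`
(liquidations of long / short positions) of intensity `lam`, and two i.i.d. square integrable
sequences of liquidation sizes `Zp`, `Zm` with mean `eta`, all of them independent. -/
structure Noise (p : Params) (μ : Measure Ω) where
  W : ℝ≥0 → Ω → ℝ
  Np : ℝ≥0 → Ω → ℕ
  Nm : ℝ≥0 → Ω → ℕ
  Zp : ℕ → Ω → ℝ
  Zm : ℕ → Ω → ℝ
  measurable_W : ∀ t, Measurable (W t)
  brownian : IsBrownianReal W μ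
  poisson_p : IsPoissonProcess Np p.lam μ
  poisson_m : IsPoissonProcess Nm p.lam μ
  measurable_Zp : ∀ i, Measurable (Zp i)
  measurable_Zm : ∀ i, Measurable (Zm i)
  indep_Zp : iIndepFun Zp μ
  indep_Zm : iIndepFun Zm μ
  ident_Zp : ∀ i j, IdentDistrib (Zp i) (Zp j) μ μ
  ident_Zm : ∀ i j, IdentDistrib (Zm i) (Zm j) μ μ
  memLp_Zp : ∀ i, MemLp (Zp i) 2 μ
  memLp_Zm : ∀ i, MemLp (Zm i) 2 μ
  mean_Zp : ∀ i, ∫ ω, Zp i ω ∂μ = p.eta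
  mean_Zm : ∀ i, ∫ ω, Zm i ω ∂μ = p.eta
  indep : iIndep ![⨆ t, MeasurableSpace.comap (W t) inferInstance,
    ⨆ t, MeasurableSpace.comap (Np t) inferInstance,
    ⨆ t, MeasurableSpace.comap (Nm t) inferInstance,
    ⨆ i, MeasurableSpace.comap (Zp i) inferInstance,
    ⨆ i, MeasurableSpace.comap (Zm i) inferInstance] μ

namespace Params

variable (p : Params)

/-- Running reward `F(q, ν) = -k ν² - b ν q - φ q² + 2 λ η r S₀`. -/
def runningReward (q nu : ℝ) : ℝ :=
  -p.k * nu ^ 2 - p.b * nu * q - p.phi * q ^ 2 + 2 * p.lam * p.eta * p.r * p.S0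

/-- Terminal penalty `G(q) = -α q²`. -/
def terminalReward (q : ℝ) : ℝ := -p.alpha * q ^ 2

/-- `φ̃ = √(φ / k)`. -/
def rate : ℝ := √(p.phi / p.k)

/-- `ξ = (α - b/2 + k φ̃) / (α - b/2 - k φ̃)`. -/
def xi : ℝ := (p.alpha - p.b / 2 + p.k * p.rate) / (p.alpha - p.b / 2 - p.k * p.rate)

/-- The coefficient of `q²` in the explicit solution. -/
def h2 (T t : ℝ) : ℝ :=
  p.k * p.rate * ((1 + p.xi * Real.exp (2 * p.rate * (T - t))) /
    (1 - p.xi * Real.exp (2 * p.rate * (T - t)))) - p.b / 2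

/-- The constant coefficient of the explicit solution; `m` is the average of the second moments
of the two liquidation sizes (so `m = η²` if the sizes are deterministic). -/
def h0 (m T t : ℝ) : ℝ :=
  2 * p.lam * m * p.k * Real.log ((p.xi - 1) /
      (p.xi * Real.exp (p.rate * (T - t)) - Real.exp (-(p.rate * (T - t))))) +
    (p.lam * m * p.b - 2 * p.r * p.lam * p.eta * p.S0) * (t - T)

/-- The explicit quadratic function `u(t, q) = h₀(t) + h₂(t) q²`. -/
def explicitSolution (m T t q : ℝ) : ℝ := p.h0 m T t + p.h2 T t * q ^ 2

/-- The feedback map `ν*(t, q) = φ̃ (ξ e^{2 φ̃ (T-t)} + 1) / (ξ e^{2 φ̃ (T-t)} - 1) q`. -/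
def feedback (T t q : ℝ) : ℝ :=
  p.rate * ((p.xi * Real.exp (2 * p.rate * (T - t)) + 1) /
    (p.xi * Real.exp (2 * p.rate * (T - t)) - 1)) * q

end Params

namespace Noise

variable {p : Params} {μ : Measure Ω} (M : Noise p μ)

/-- The average `(E[(ζ⁺)²] + E[(ζ⁻)²]) / 2` of the second moments of the liquidation sizes. -/
def secondMoment : ℝ := ((∫ ω, M.Zp 1 ω ^ 2 ∂μ) + ∫ ω, M.Zm 1 ω ^ 2 ∂μ) / 2

theorem measurable_size {N : Ω → ℕ} {Z : ℕ → Ω → ℝ} (hN : Measurable N)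
    (hZ : ∀ i, Measurable (Z i)) : Measurable fun ω => Z (N ω) ω := by
  have h : Measurable fun x : ℕ × Ω => Z x.1 x.2 := measurable_from_prod_countable_right hZ
  exact h.comp (hN.prodMk measurable_id)

/-- The filtration `F_t = σ(W_r, N^±_r, ζ^±_{N^±_r} ; r ≤ t)`. -/
def filtration : Filtration ℝ≥0 mΩ where
  seq t := ⨆ s ≤ t, (MeasurableSpace.comap (M.W s) inferInstance ⊔
    MeasurableSpace.comap (M.Np s) inferInstance ⊔
    MeasurableSpace.comap (M.Nm s) inferInstance ⊔
    MeasurableSpace.comap (fun ω => M.Zp (M.Np s ω) ω) inferInstance ⊔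
    MeasurableSpace.comap (fun ω => M.Zm (M.Nm s ω) ω) inferInstance)
  mono' _ _ hij := biSup_mono fun _ => ge_trans hij
  le' t := by
    refine iSup₂_le fun s _ => ?_
    refine sup_le (sup_le (sup_le (sup_le ?_ ?_) ?_) ?_) ?_
    · exact (M.measurable_W s).comap_le
    · exact (M.poisson_p.measurable s).comap_le
    · exact (M.poisson_m.measurable s).comap_le
    · exact (measurable_size (M.poisson_p.measurable s) M.measurable_Zp).comap_le
    · exact (measurable_size (M.poisson_m.measurable s) M.measurable_Zm).comap_le

/-- Admissible controls on `[t, T]`, for `0 ≤ t`: progressively measurable on `[t, T]` with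
`E ∫_t^T |ν_s|² ds < ∞`. Only the values `ν s ω` with `s ∈ [t, T]` matter. -/
def admissible (t T : ℝ) : Set (ℝ → Ω → ℝ) :=
  {nu | (∀ s ∈ Icc t T,
      Measurable[(Subtype.instMeasurableSpace : MeasurableSpace (Icc t s)).prod
        (M.filtration s.toNNReal)] fun x : Icc t s × Ω => nu x.1 x.2) ∧
    ∫⁻ ω, (∫⁻ s in Icc t T, ‖nu s ω‖ₑ ^ 2) ∂μ < ∞}

/-- The inventory at time `s ≥ t ≥ 0` when it equals `q` at time `t` and the trading speed is `nu`:
`Q_s = q - ∫_t^s ν_u du + ∑_{N⁺_t < i ≤ N⁺_s} ζ⁺_i - ∑_{N⁻_t < i ≤ N⁻_s} ζ⁻_i`, that is,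
`dQ = -ν dt + ζ⁺_{N⁺} dN⁺ - ζ⁻_{N⁻} dN⁻`. -/
def inventory (t q : ℝ) (nu : ℝ → Ω → ℝ) (s : ℝ) (ω : Ω) : ℝ :=
  q - (∫ u in t..s, nu u ω) +
    ∑ i ∈ Finset.Ioc (M.Np t.toNNReal ω) (M.Np s.toNNReal ω), M.Zp i ω -
    ∑ i ∈ Finset.Ioc (M.Nm t.toNNReal ω) (M.Nm s.toNNReal ω), M.Zm i ω

/-- The expected reward `E[∫_t^T F(Q_s, ν_s) ds + G(Q_T)], Q_t = q,` of a control. -/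
def reward (t T q : ℝ) (nu : ℝ → Ω → ℝ) : ℝ :=
  ∫ ω, ((∫ s in t..T, p.runningReward (M.inventory t q nu s ω) (nu s ω)) +
    p.terminalReward (M.inventory t q nu T ω)) ∂μ

/-- The value function: the supremum of the expected reward over the admissible controls, taken
in the extended reals. -/
def value (t T q : ℝ) : EReal :=
  ⨆ nu ∈ M.admissible t T, (M.reward t T q nu : EReal)

end Noise

end Liquidation

end

/-! The theorem follows by completing the square in the expected reward. Write Q = B + X, where B_s
= q - ∫_t^s ν is absolutely continuous and X is the net jump process. Long and short liquidations
have the same compensator λη ds, so X is centred, its increments after s are orthogonal to every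
square integrable 𝓕_s-measurable variable, and E X_s² = 2λm(s - t).

These three facts replace stochastic calculus. In the expansion of h₂(T) Q_T², the term h₂B² obeys a
pathwise product rule. For 2h₂BX, the product rule for h₂B is multiplied by X_T, and X_T is then
replaced by X_s under the expectation. The term h₂X² needs only the variance. The result is Dynkin's
formula, `integral_mul_sq_state`.

The function h₂ solves the Riccati equation h₂' = φ - (b + 2h₂)²/(4k) with h₂(T) = -α. This is what
turns F plus the Dynkin integrand into a constant minus k(ν - ν*)²; the constant and the accumulated
variance integrate to h₀. Hence `Noise.reward_eq`: the reward of any admissible ν is u(t,q) - k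
E∫(ν_s - ν*(s,Q_s))² ds. So v ≤ u, with equality for a control that follows the feedback.

Two points need care. The filtration reveals the marks already used, so orthogonality is proved one
mark at a time (`IsMarkedPoisson.integral_mul_jumps`). And the optimal control must exist: for a
given jump path the closed-loop equation is linear in B, and variation of constants solves it for
every ω (`Params.integral_feedback_optimalDrift`). -/

namespace Liquidation

/-! ### Independence of Poisson increments from the past -/

section Independence

variable {Ω : Type*} {mΩ : MeasurableSpace Ω} {μ : Measure Ω}

/-- If `A₁`, `A₂` are independent sub-σ-algebras of a σ-algebra that is independent of `B`, then
`A₁` is independent of `A₂ ⊔ B`. -/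
theorem indep_sup_right [IsProbabilityMeasure μ] {A A₁ A₂ B : MeasurableSpace Ω}
    (hA : A ≤ mΩ) (hB : B ≤ mΩ) (h₁ : A₁ ≤ A) (h₂ : A₂ ≤ A)
    (h12 : Indep A₁ A₂ μ) (hAB : Indep A B μ) : Indep A₁ (A₂ ⊔ B) μ := by
  -- Intersections a ∩ b form a π-system generating `A₂ ⊔ B`, and on them the product formula
  -- follows from the two given independences.
  let π : Set (Set Ω) := image2 (· ∩ ·) {a | MeasurableSet[A₂] a} {b | MeasurableSet[B] b}
  have hπ : IsPiSystem π := by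
    rintro _ ⟨a, ha, b, hb, rfl⟩ _ ⟨a', ha', b', hb', rfl⟩ -
    refine ⟨a ∩ a', ?_, b ∩ b', ?_, ?_⟩
    · exact @MeasurableSet.inter _ A₂ _ _ ha ha'
    · exact @MeasurableSet.inter _ B _ _ hb hb'
    · exact inter_inter_inter_comm a a' b b'
  have hgen : A₂ ⊔ B = MeasurableSpace.generateFrom π := by
    apply le_antisymm
    · refine sup_le ?_ ?_
      · intro a ha
        exact MeasurableSpace.measurableSet_generateFrom
          ⟨a, ha, univ, @MeasurableSet.univ _ B, inter_univ a⟩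
      · intro b hb
        exact MeasurableSpace.measurableSet_generateFrom
          ⟨univ, @MeasurableSet.univ _ A₂, b, hb, univ_inter b⟩
    · refine MeasurableSpace.generateFrom_le ?_
      rintro _ ⟨a, ha, b, hb, rfl⟩
      exact @MeasurableSet.inter _ (A₂ ⊔ B) _ _
        ((le_sup_left : A₂ ≤ A₂ ⊔ B) _ ha) ((le_sup_right : B ≤ A₂ ⊔ B) _ hb)
  refine IndepSets.indep (h₁.trans hA) (sup_le (h₂.trans hA) hB)
    (@MeasurableSpace.isPiSystem_measurableSet Ω A₁) hπ
    (@MeasurableSpace.generateFrom_measurableSet Ω A₁).symm hgen ?_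
  rw [IndepSets_iff]
  rintro a₁ _ ha₁ ⟨a, ha, b, hb, rfl⟩
  rw [Indep_iff] at h12 hAB
  change μ (a₁ ∩ (a ∩ b)) = μ a₁ * μ (a ∩ b)
  rw [← inter_assoc, hAB _ _ (@MeasurableSet.inter _ A _ _ (h₁ _ ha₁) (h₂ _ ha)) hb,
    h12 _ _ ha₁ ha, hAB _ _ (h₂ _ ha) hb, mul_assoc]

/-- A nondecreasing list of times starting at `0`, enumerating a finite set of times up to `s`,
followed by `s` and `T`. -/
theorem exists_monotone_times (I : Finset ℝ≥0) {s T : ℝ≥0} (hI : ∀ r ∈ I, r ≤ s) (hsT : s ≤ T) :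
    ∃ (n : ℕ) (τ : ℕ → ℝ≥0), Monotone τ ∧ τ 0 = 0 ∧ τ n = s ∧ τ (n + 1) = T ∧
      ∀ r ∈ I, ∃ k ≤ n, τ k = r := by
  let e := I.orderEmbOfFin rfl
  -- The order is 0, the points of `I`, then `s`, then `T` forever. Repetitions are harmless, since
  -- only monotonicity is needed.
  let τ : ℕ → ℝ≥0 := fun k => if k = 0 then 0 else if h : k - 1 < I.card then e ⟨k - 1, h⟩ else
    if k = I.card + 1 then s else T
  have hmem : ∀ i, e i ∈ I := fun i => I.orderEmbOfFin_mem rfl i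
  refine ⟨I.card + 1, τ, ?_, by simp [τ], by simp [τ], by simp [τ], ?_⟩
  · refine monotone_nat_of_le_succ fun k => ?_
    by_cases h0 : k = 0
    · simp [τ, h0]
    · simp only [τ, h0, if_false, Nat.succ_ne_zero, Nat.add_sub_cancel]
      by_cases h1 : k < I.card
      · have h2 : k - 1 < I.card := by omega
        rw [dif_pos h1, dif_pos h2]
        exact e.monotone (by simp)
      · rw [dif_neg h1]
        by_cases h2 : k - 1 < I.card
        · rw [dif_pos h2]
          split_ifs
          · exact hI _ (hmem _)
          · exact (hI _ (hmem _)).trans hsT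
        · rw [dif_neg h2]
          split_ifs <;> first | omega | exact hsT | exact le_rfl
  · intro r hr
    obtain ⟨i, hi⟩ : r ∈ Set.range e := by
      rw [Finset.range_orderEmbOfFin]; exact hr
    refine ⟨i + 1, by have := i.2; omega, ?_⟩
    simp [τ, hi]

/-- Independent increments speak of finite grids only. Any finitely many past times fit in a grid
from 0 to `s` followed by `T`, and N_r is the sum of the grid increments up to r because N_0 = 0. -/
theorem IsPoissonProcess.indep_increment [IsProbabilityMeasure μ] {N : ℝ≥0 → Ω → ℕ} {lam : ℝ≥0}
    (hN : IsPoissonProcess N lam μ) {s T : ℝ≥0} (hsT : s ≤ T) :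
    Indep (MeasurableSpace.comap (fun ω => N T ω - N s ω) inferInstance)
      (⨆ r ≤ s, MeasurableSpace.comap (N r) inferInstance) μ := by
  have hm : ∀ r, Measurable fun ω => (N r ω : ℝ) := fun r =>
    measurable_from_top.comp (hN.measurable r)
  have key : IndepFun (fun ω (r : Iic s) => (N r ω : ℝ)) (fun ω => (N T ω : ℝ) - N s ω) μ := by
    refine IndepFun.process_indepFun (fun r => hm r) ((hm T).sub (hm s)) fun J => ?_
    obtain ⟨n, τ, hτ, h0, hn, hn1, hk⟩ := exists_monotone_times (J.image Subtype.val)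
      (s := s) (T := T) (by simp +contextual) hsT
    choose! κ hκ hκ' using hk
    have hi := (hN.indep_increments.nat hτ).indepFun_finset (Finset.range n) ({n} : Finset ℕ) (by simp)
      (fun i => (hm _).sub (hm _))
    have h2 := hi.comp
      (φ := fun (x : Finset.range n → ℝ) (r : J) =>
        ∑ j : Finset.range n, if (j : ℕ) < κ r then x j else 0)
      (ψ := fun (x : ({n} : Finset ℕ) → ℝ) => x ⟨n, by simp⟩)
      (by
        refine measurable_pi_lambda _ fun r => Finset.measurable_sum _ fun j _ => ?_
        split_ifs
        · exact measurable_pi_apply j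
        · exact measurable_const)
      (measurable_pi_apply (X := fun _ : ({n} : Finset ℕ) => ℝ) ⟨n, by simp⟩)
    convert! h2 using 1
    · funext ω r
      have hr : (r.1 : ℝ≥0) ∈ J.image Subtype.val := Finset.mem_image_of_mem _ r.2
      have e1 : ∑ j : Finset.range n, (if (j : ℕ) < κ r then
          ((N (τ (j + 1)) ω : ℝ) - N (τ j) ω) else 0) =
          ∑ j ∈ Finset.range n, (if j < κ r then ((N (τ (j + 1)) ω : ℝ) - N (τ j) ω) else 0) :=
        Finset.sum_coe_sort (Finset.range n)
          (fun j => if j < κ r then ((N (τ (j + 1)) ω : ℝ) - N (τ j) ω) else 0)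
      simp only [Function.comp]
      rw [e1, ← Finset.sum_filter]
      have e2 : (Finset.range n).filter (fun j => j < κ r) = Finset.range (κ r) := by
        ext j; have := hκ _ hr; simp; omega
      rw [e2, Finset.sum_range_sub (fun j => (N (τ j) ω : ℝ)), hκ' _ hr, h0, hN.zero]
      simp
    · funext ω
      simp [hn, hn1]
  rw [IndepFun_iff_Indep] at key
  refine (indep_of_indep_of_le key ?_ ?_).symm
  · refine iSup₂_le fun r hr => ?_
    rw [← measurable_iff_comap_le]
    have h1 : Measurable[MeasurableSpace.comap (fun ω (r : Iic s) => (N r ω : ℝ)) inferInstance]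
        fun ω => (N r ω : ℝ) :=
      (measurable_pi_apply (⟨r, hr⟩ : Iic s)).comp
        (comap_measurable (fun ω (r : Iic s) => (N r ω : ℝ)))
    have h2 : N r = (fun x : ℝ => ⌊x⌋₊) ∘ fun ω => (N r ω : ℝ) := by funext ω; simp
    rw [h2]
    exact Nat.measurable_floor.comp h1
  · rw [← measurable_iff_comap_le]
    -- Monotonicity makes truncated subtraction agree with real subtraction, so the floor of the
    -- real increment recovers it.
    have h2 : (fun ω => N T ω - N s ω) = (fun x : ℝ => ⌊x⌋₊) ∘ fun ω => (N T ω : ℝ) - N s ω := by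
      funext ω
      simp only [Function.comp]
      rw [← Nat.cast_sub (hN.mono ω hsT), Nat.floor_natCast]
    rw [h2]
    exact Nat.measurable_floor.comp (comap_measurable _)

end Independence

/-! ### Moments of the Poisson law -/

section Moments

-- Since n rⁿ/n! = r · rⁿ⁻¹/(n-1)!, a Poisson variable satisfies E[N f(N)] = r E[f(N+1)]. Taking f =
-- 1 and f(n) = n yields the first two moments.
open Real in
theorem hasSum_poisson_mul (r : ℝ≥0) (f : ℕ → ℝ) {c : ℝ}
    (h : HasSum (fun n => exp (-r) * r ^ n / (n.factorial : ℝ) * f (n + 1)) c) :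
    HasSum (fun n => exp (-r) * r ^ n / (n.factorial : ℝ) * (n * f n)) (r * c) := by
  rw [← hasSum_nat_add_iff' 1]
  simp only [Finset.range_one, Finset.sum_singleton, Nat.cast_zero, zero_mul, mul_zero, sub_zero]
  refine (h.mul_left (r : ℝ)).congr_fun fun n => ?_
  rw [Nat.factorial_succ]
  push_cast
  have : (n.factorial : ℝ) ≠ 0 := by positivity
  field_simp
  ring

theorem hasSum_poisson_id (r : ℝ≥0) :
    HasSum (fun n : ℕ => Real.exp (-r) * r ^ n / (n.factorial : ℝ) * (n : ℝ)) r := by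
  simpa using hasSum_poisson_mul r (fun _ => 1) (c := 1) (by simpa using hasSum_one_poissonMeasure r)

theorem hasSum_poisson_sq (r : ℝ≥0) :
    HasSum (fun n : ℕ => Real.exp (-r) * r ^ n / (n.factorial : ℝ) * (n : ℝ) ^ 2) (r * (r + 1)) := by
  have h : HasSum (fun n : ℕ => Real.exp (-r) * r ^ n / (n.factorial : ℝ) * ((n + 1 : ℕ) : ℝ))
      (r + 1) := by
    refine ((hasSum_poisson_id r).add (hasSum_one_poissonMeasure r)).congr_fun fun n => ?_
    push_cast; ring
  simpa [sq] using hasSum_poisson_mul r (fun n => (n : ℝ)) h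

theorem integrable_sq_poissonMeasure (r : ℝ≥0) :
    Integrable (fun n : ℕ => (n : ℝ) ^ 2) (poissonMeasure r) := by
  rw [integrable_poissonMeasure_iff]
  simpa using (hasSum_poisson_sq r).summable

theorem integrable_id_poissonMeasure (r : ℝ≥0) :
    Integrable (fun n : ℕ => (n : ℝ)) (poissonMeasure r) := by
  rw [integrable_poissonMeasure_iff]
  simpa using (hasSum_poisson_id r).summable

theorem integral_id_poissonMeasure (r : ℝ≥0) : ∫ n : ℕ, (n : ℝ) ∂poissonMeasure r = r :=
  (hasSum_integral_poissonMeasure (integrable_id_poissonMeasure r)).unique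
    (by simpa using hasSum_poisson_id r)

theorem integral_sq_poissonMeasure (r : ℝ≥0) :
    ∫ n : ℕ, (n : ℝ) ^ 2 ∂poissonMeasure r = r * (r + 1) :=
  (hasSum_integral_poissonMeasure (integrable_sq_poissonMeasure r)).unique
    (by simpa using hasSum_poisson_sq r)

end Moments

/-! ### Second moments of random sums -/

section CompoundSums

variable {Ω : Type*} {mΩ : MeasurableSpace Ω} {μ : Measure Ω}

theorem integral_sq_sum [IsProbabilityMeasure μ] {Z : ℕ → Ω → ℝ} (hind : iIndepFun Z μ)
    (hL2 : ∀ i, MemLp (Z i) 2 μ) {eta m2 : ℝ} (hmean : ∀ i, ∫ ω, Z i ω ∂μ = eta)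
    (hm2 : ∀ i, ∫ ω, Z i ω ^ 2 ∂μ = m2) (S : Finset ℕ) :
    ∫ ω, (∑ i ∈ S, Z i ω) ^ 2 ∂μ = (m2 - eta ^ 2) * S.card + eta ^ 2 * (S.card : ℝ) ^ 2 := by
  have hS : MemLp (∑ i ∈ S, Z i) 2 μ := memLp_finsetSum' S fun i _ => hL2 i
  have h1 := variance_eq_sub hS
  have h2 := IndepFun.variance_sum (μ := μ) (X := Z) (s := S) (fun i _ => hL2 i)
    (fun i _ j _ hij => hind.indepFun hij)
  have h3 : ∀ i, variance (Z i) μ = m2 - eta ^ 2 := fun i => by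
    rw [variance_eq_sub (hL2 i), ← hm2 i, ← hmean i]
    simp
  have h4 : μ[∑ i ∈ S, Z i] = S.card * eta := by
    simp only [Finset.sum_apply]
    rw [integral_finsetSum S fun i _ => (hL2 i).integrable one_le_two]
    simp [hmean]
  have h5 : μ[(∑ i ∈ S, Z i) ^ 2] = ∫ ω, (∑ i ∈ S, Z i ω) ^ 2 ∂μ := by
    simp [Finset.sum_apply]
  rw [h4, h5, h2, Finset.sum_congr rfl fun i _ => h3 i, Finset.sum_const, nsmul_eq_mul] at h1
  linarith

theorem measurable_sum_Ioc {α : Type*} [MeasurableSpace α] {f : ℕ → α → ℝ}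
    (hf : ∀ i, Measurable (f i)) :
    Measurable fun x : (ℕ × ℕ) × α => ∑ i ∈ Finset.Ioc x.1.1 x.1.2, f i x.2 :=
  measurable_from_prod_countable_right fun j =>
    Finset.measurable_sum (Finset.Ioc j.1 j.2) fun i _ => hf i

/-- Second moment of a sum of independent variables over a random range of indices that is
independent of them. -/
theorem memLp_integral_sq_sum_random [IsProbabilityMeasure μ] {Z : ℕ → Ω → ℝ} {A B : Ω → ℕ}
    (hA : Measurable A) (hB : Measurable B)
    (hZ : ∀ i, Measurable (Z i)) (hind : iIndepFun Z μ)
    (hL2 : ∀ i, MemLp (Z i) 2 μ) {eta m2 : ℝ} (hmean : ∀ i, ∫ ω, Z i ω ∂μ = eta)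
    (hm2 : ∀ i, ∫ ω, Z i ω ^ 2 ∂μ = m2)
    (hindep : Indep (MeasurableSpace.comap (fun ω => (A ω, B ω)) inferInstance)
      (⨆ i, MeasurableSpace.comap (Z i) inferInstance) μ)
    (h1 : Integrable (fun ω => ((B ω - A ω : ℕ) : ℝ)) μ)
    (h2 : Integrable (fun ω => ((B ω - A ω : ℕ) : ℝ) ^ 2) μ) :
    MemLp (fun ω => ∑ i ∈ Finset.Ioc (A ω) (B ω), Z i ω) 2 μ ∧
    ∫ ω, (∑ i ∈ Finset.Ioc (A ω) (B ω), Z i ω) ^ 2 ∂μ =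
      (m2 - eta ^ 2) * ∫ ω, ((B ω - A ω : ℕ) : ℝ) ∂μ +
        eta ^ 2 * ∫ ω, ((B ω - A ω : ℕ) : ℝ) ^ 2 ∂μ := by
  let J : Ω → ℕ × ℕ := fun ω => (A ω, B ω)
  have hJ : Measurable J := hA.prodMk hB
  let ζ : Ω → ℕ → ℝ := fun ω i => Z i ω
  have hζ : Measurable ζ := measurable_pi_lambda _ hZ
  have hJζ : IndepFun J ζ μ := by
    rw [IndepFun_iff_Indep]
    refine indep_of_indep_of_le_right hindep ?_
    simp only [MeasurableSpace.pi, MeasurableSpace.comap_iSup, MeasurableSpace.comap_comp]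
    exact le_rfl
  let F : (ℕ × ℕ) × (ℕ → ℝ) → ℝ := fun x => (∑ i ∈ Finset.Ioc x.1.1 x.1.2, x.2 i) ^ 2
  have hF : Measurable F :=
    (measurable_sum_Ioc (α := ℕ → ℝ) (f := fun i z => z i) fun i => measurable_pi_apply i).pow_const 2
  -- Under the product law, conditioning on the index range is Fubini, and each section is a sum
  -- over a fixed range.
  have hmap : μ.map (fun ω => (J ω, ζ ω)) = (μ.map J).prod (μ.map ζ) :=
    (indepFun_iff_map_prod_eq_prod_map_map hJ.aemeasurable hζ.aemeasurable).1 hJζ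
  have := Measure.isProbabilityMeasure_map (μ := μ) hJ.aemeasurable
  have := Measure.isProbabilityMeasure_map (μ := μ) hζ.aemeasurable
  have hsec : ∀ j : ℕ × ℕ, ∫ z, F (j, z) ∂μ.map ζ =
      (m2 - eta ^ 2) * ((j.2 - j.1 : ℕ) : ℝ) + eta ^ 2 * ((j.2 - j.1 : ℕ) : ℝ) ^ 2 := fun j => by
    refine (integral_map hζ.aemeasurable (f := fun z => F (j, z))
      (hF.comp measurable_prodMk_left).aestronglyMeasurable).trans ?_
    rw [← Nat.card_Ioc]
    exact integral_sq_sum hind hL2 hmean hm2 (Finset.Ioc j.1 j.2)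
  have hFi : Integrable F ((μ.map J).prod (μ.map ζ)) := by
    rw [integrable_prod_iff hF.aestronglyMeasurable]
    refine ⟨Filter.Eventually.of_forall fun j => ?_, ?_⟩
    · refine (integrable_map_measure (g := fun z => F (j, z))
        (hF.comp measurable_prodMk_left).aestronglyMeasurable hζ.aemeasurable).2 ?_
      exact (memLp_finsetSum (Finset.Ioc j.1 j.2) fun i _ => hL2 i).integrable_sq
    · have e : (fun j => ∫ z, ‖F (j, z)‖ ∂μ.map ζ) = fun j : ℕ × ℕ =>
          (m2 - eta ^ 2) * ((j.2 - j.1 : ℕ) : ℝ) + eta ^ 2 * ((j.2 - j.1 : ℕ) : ℝ) ^ 2 := by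
        funext j
        rw [← hsec j]
        refine integral_congr_ae (Filter.Eventually.of_forall fun z => ?_)
        exact Real.norm_of_nonneg (sq_nonneg _)
      rw [e, integrable_map_measure .of_discrete hJ.aemeasurable]
      exact (h1.const_mul _).add (h2.const_mul _)
  have hm : Measurable fun ω => ∑ i ∈ Finset.Ioc (A ω) (B ω), Z i ω :=
    (measurable_sum_Ioc hZ).comp (hJ.prodMk measurable_id)
  constructor
  · rw [memLp_two_iff_integrable_sq hm.aestronglyMeasurable]
    rw [← hmap, integrable_map_measure hF.aestronglyMeasurable (hJ.prodMk hζ).aemeasurable] at hFi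
    exact hFi
  · have e1 : ∫ ω, (∑ i ∈ Finset.Ioc (A ω) (B ω), Z i ω) ^ 2 ∂μ =
        ∫ x, F x ∂(μ.map J).prod (μ.map ζ) := by
      rw [← hmap, integral_map (hJ.prodMk hζ).aemeasurable hF.aestronglyMeasurable]
    rw [e1, integral_prod _ hFi]
    simp only [hsec]
    rw [integral_map hJ.aemeasurable .of_discrete, integral_add (h1.const_mul _) (h2.const_mul _),
      integral_const_mul, integral_const_mul]

end CompoundSums

/-! ### Moments of Poisson increments and of marked Poisson sums -/

namespace IsPoissonProcess

variable {Ω : Type*} {mΩ : MeasurableSpace Ω} {μ : Measure Ω} {N : ℝ≥0 → Ω → ℕ} {lam : ℝ≥0}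

theorem hasLaw_increment (hN : IsPoissonProcess N lam μ) {s T : ℝ≥0} (hsT : s ≤ T) :
    HasLaw (fun ω => N T ω - N s ω) (poissonMeasure (lam * (T - s))) μ := by
  have := hN.law_increment s (T - s)
  rwa [add_tsub_cancel_of_le hsT] at this

theorem integrable_increment (hN : IsPoissonProcess N lam μ) {s T : ℝ≥0} (hsT : s ≤ T) :
    Integrable (fun ω => ((N T ω - N s ω : ℕ) : ℝ)) μ := by
  have h := hN.hasLaw_increment hsT
  have h2 := integrable_id_poissonMeasure (lam * (T - s))
  rw [← h.map_eq, integrable_map_measure .of_discrete h.aemeasurable] at h2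
  exact h2

theorem integrable_sq_increment (hN : IsPoissonProcess N lam μ) {s T : ℝ≥0} (hsT : s ≤ T) :
    Integrable (fun ω => ((N T ω - N s ω : ℕ) : ℝ) ^ 2) μ := by
  have h := hN.hasLaw_increment hsT
  have h2 := integrable_sq_poissonMeasure (lam * (T - s))
  rw [← h.map_eq, integrable_map_measure .of_discrete h.aemeasurable] at h2
  exact h2

theorem integral_increment (hN : IsPoissonProcess N lam μ) {s T : ℝ≥0} (hsT : s ≤ T) :
    ∫ ω, ((N T ω - N s ω : ℕ) : ℝ) ∂μ = lam * (T - s) := by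
  have h := hN.hasLaw_increment hsT
  have h2 := integral_id_poissonMeasure (lam * (T - s))
  rw [← h.map_eq, integral_map h.aemeasurable .of_discrete] at h2
  rw [h2]
  push_cast [NNReal.coe_sub hsT]
  rfl

theorem integral_sq_increment (hN : IsPoissonProcess N lam μ) {s T : ℝ≥0} (hsT : s ≤ T) :
    ∫ ω, ((N T ω - N s ω : ℕ) : ℝ) ^ 2 ∂μ = lam * (T - s) * (lam * (T - s) + 1) := by
  have h := hN.hasLaw_increment hsT
  have h2 := integral_sq_poissonMeasure (lam * (T - s))
  rw [← h.map_eq, integral_map h.aemeasurable .of_discrete] at h2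
  rw [h2]
  push_cast [NNReal.coe_sub hsT]
  rfl

end IsPoissonProcess

/-- A Poisson process `N` with square integrable i.i.d. marks `Z`, and a σ-algebra `R` such that
`N`, `Z` and `R` are independent. -/
structure IsMarkedPoisson {Ω : Type*} (R : MeasurableSpace Ω) {mΩ : MeasurableSpace Ω}
    (N : ℝ≥0 → Ω → ℕ) (Z : ℕ → Ω → ℝ) (lam : ℝ≥0) (eta m2 : ℝ) (μ : Measure Ω) : Prop where
  poisson : IsPoissonProcess N lam μ
  measurable_mark : ∀ i, Measurable (Z i)
  indep_mark : iIndepFun Z μ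
  ident_mark : ∀ i j, IdentDistrib (Z i) (Z j) μ μ
  memLp_mark : ∀ i, MemLp (Z i) 2 μ
  mean_mark : ∀ i, ∫ ω, Z i ω ∂μ = eta
  sq_mark : ∀ i, ∫ ω, Z i ω ^ 2 ∂μ = m2
  le_rest : R ≤ mΩ
  indep_left : Indep (⨆ r, MeasurableSpace.comap (N r) inferInstance)
    ((⨆ i, MeasurableSpace.comap (Z i) inferInstance) ⊔ R) μ
  indep_right : Indep (⨆ i, MeasurableSpace.comap (Z i) inferInstance)
    ((⨆ r, MeasurableSpace.comap (N r) inferInstance) ⊔ R) μ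

namespace IsMarkedPoisson

variable {Ω : Type*} {R : MeasurableSpace Ω} {mΩ : MeasurableSpace Ω} {μ : Measure Ω}
  {N : ℝ≥0 → Ω → ℕ} {Z : ℕ → Ω → ℝ} {lam : ℝ≥0} {eta m2 : ℝ}

theorem comap_count_le (h : IsMarkedPoisson R N Z lam eta m2 μ) :
    (⨆ r, MeasurableSpace.comap (N r) inferInstance) ≤ mΩ :=
  iSup_le fun r => (h.poisson.measurable r).comap_le

theorem comap_mark_le (h : IsMarkedPoisson R N Z lam eta m2 μ) :
    (⨆ i, MeasurableSpace.comap (Z i) inferInstance) ≤ mΩ :=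
  iSup_le fun i => (h.measurable_mark i).comap_le

theorem memLp_integral_sq_jumps [IsProbabilityMeasure μ]
    (h : IsMarkedPoisson R N Z lam eta m2 μ) {s T : ℝ≥0} (hsT : s ≤ T) :
    MemLp (fun ω => ∑ i ∈ Finset.Ioc (N s ω) (N T ω), Z i ω) 2 μ ∧
    ∫ ω, (∑ i ∈ Finset.Ioc (N s ω) (N T ω), Z i ω) ^ 2 ∂μ =
      lam * (T - s) * m2 + (lam * (T - s) * eta) ^ 2 := by
  have hind : Indep (MeasurableSpace.comap (fun ω => (N s ω, N T ω)) inferInstance)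
      (⨆ i, MeasurableSpace.comap (Z i) inferInstance) μ := by
    refine indep_of_indep_of_le h.indep_left ?_ le_sup_left
    rw [← measurable_iff_comap_le]
    refine Measurable.prodMk ?_ ?_ <;> rw [measurable_iff_comap_le]
    · exact le_iSup (fun r => MeasurableSpace.comap (N r) inferInstance) s
    · exact le_iSup (fun r => MeasurableSpace.comap (N r) inferInstance) T
  obtain ⟨h1, h2⟩ := memLp_integral_sq_sum_random (h.poisson.measurable s) (h.poisson.measurable T) h.measurable_mark h.indep_mark h.memLp_mark h.mean_mark
    h.sq_mark hind (h.poisson.integrable_increment hsT) (h.poisson.integrable_sq_increment hsT)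
  refine ⟨h1, h2.trans ?_⟩
  rw [h.poisson.integral_increment hsT, h.poisson.integral_sq_increment hsT]
  ring

/-- Passing to absolute marks makes the moment bounds available for dominating variables, which the
interchange of series and expectation and the uniform bound on jumps require. -/
theorem abs (h : IsMarkedPoisson R N Z lam eta m2 μ) :
    IsMarkedPoisson R N (fun i ω => |Z i ω|) lam (∫ ω, |Z 0 ω| ∂μ) m2 μ where
  poisson := h.poisson
  measurable_mark i := (h.measurable_mark i).abs
  indep_mark := h.indep_mark.comp (fun _ x => |x|) fun _ => measurable_id.abs
  ident_mark i j := (h.ident_mark i j).comp measurable_id.abs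
  memLp_mark i := (h.memLp_mark i).abs
  mean_mark i := ((h.ident_mark i 0).comp measurable_id.abs).integral_eq
  sq_mark i := by simpa only [sq_abs] using h.sq_mark i
  le_rest := h.le_rest
  indep_left := by
    refine indep_of_indep_of_le_right h.indep_left (sup_le_sup_right ?_ _)
    refine iSup_mono fun i => ?_
    rw [← measurable_iff_comap_le]
    exact continuous_abs.measurable.comp (comap_measurable (Z i))
  indep_right := by
    refine indep_of_indep_of_le_left h.indep_right ?_
    refine iSup_mono fun i => ?_
    rw [← measurable_iff_comap_le]
    exact continuous_abs.measurable.comp (comap_measurable (Z i))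

end IsMarkedPoisson

/-- A sum over a random range is a series over all i with indicators. Dominated convergence allows
the expectation term by term, so that each mark can be treated separately. -/
theorem hasSum_integral_mul_sum_Ioc {Ω : Type*} {mΩ : MeasurableSpace Ω} {μ : Measure Ω}
    {A B : Ω → ℕ} (hA : Measurable A) (hB : Measurable B) {Y : Ω → ℝ} (hY : Measurable Y)
    {z : ℕ → Ω → ℝ} (hz : ∀ i, Measurable (z i))
    (hint : Integrable (fun ω => |Y ω| * ∑ i ∈ Finset.Ioc (A ω) (B ω), |z i ω|) μ) :
    HasSum (fun i => ∫ ω, {ω | A ω < i ∧ i ≤ B ω}.indicator Y ω * z i ω ∂μ)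
      (∫ ω, Y ω * ∑ i ∈ Finset.Ioc (A ω) (B ω), z i ω ∂μ) := by
  have hE : ∀ i, MeasurableSet {ω | A ω < i ∧ i ≤ B ω} := fun i =>
    (measurableSet_lt hA measurable_const).inter (measurableSet_le measurable_const hB)
  have hsum : ∀ (y : ℝ) (w : ℕ → ℝ) (ω : Ω), HasSum (L := .unconditional ℕ)
      (fun i => {ω | A ω < i ∧ i ≤ B ω}.indicator (fun _ => y) ω * w i)
      (y * ∑ i ∈ Finset.Ioc (A ω) (B ω), w i) := fun y w ω => by
    have h := hasSum_sum_of_ne_finset_zero (L := .unconditional ℕ) (s := Finset.Ioc (A ω) (B ω))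
      (f := fun i => {ω | A ω < i ∧ i ≤ B ω}.indicator (fun _ => y) ω * w i) (fun i hi => by
        rw [indicator_of_notMem (by simpa using hi), zero_mul])
    rwa [Finset.sum_congr rfl (g := fun i => y * w i) (fun i hi => by
        rw [indicator_of_mem (by simpa using hi)]), ← Finset.mul_sum] at h
  refine hasSum_integral_of_dominated_convergence
    (fun i ω => {ω | A ω < i ∧ i ≤ B ω}.indicator (fun _ => |Y ω|) ω * |z i ω|)
    (fun i => ((hY.indicator (hE i)).mul (hz i)).aestronglyMeasurable)
    (fun i => Filter.Eventually.of_forall fun ω => ?_)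
    (Filter.Eventually.of_forall fun ω => (hsum _ (fun i => |z i ω|) ω).summable) ?_
    (Filter.Eventually.of_forall fun ω => hsum (Y ω) (fun i => z i ω) ω)
  · rw [norm_mul, norm_indicator_eq_indicator_norm]
    exact le_rfl
  · simpa only [(hsum _ _ _).tsum_eq] using hint

/-! ### Orthogonality of the compensated jumps to the past -/

namespace IsMarkedPoisson

variable {Ω : Type*} {R : MeasurableSpace Ω} {mΩ : MeasurableSpace Ω} {μ : Measure Ω}
  {N : ℝ≥0 → Ω → ℕ} {Z : ℕ → Ω → ℝ} {lam : ℝ≥0} {eta m2 : ℝ}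

/-- The information generated up to time `s` by the process and its marks, together with `R`. -/
@[reducible] def past {Ω : Type*} (R : MeasurableSpace Ω) (N : ℝ≥0 → Ω → ℕ) (Z : ℕ → Ω → ℝ) (s : ℝ≥0) :
    MeasurableSpace Ω :=
  R ⊔ ⨆ r ≤ s, (MeasurableSpace.comap (N r) inferInstance ⊔
    MeasurableSpace.comap (fun ω => Z (N r ω) ω) inferInstance)

/-- The information generated by the process, all the marks but the `i`-th, and `R`. -/
@[reducible] def others {Ω : Type*} (R : MeasurableSpace Ω) (N : ℝ≥0 → Ω → ℕ) (Z : ℕ → Ω → ℝ) (i : ℕ) :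
    MeasurableSpace Ω :=
  (⨆ j ∈ ({i}ᶜ : Set ℕ), MeasurableSpace.comap (Z j) inferInstance) ⊔
    ((⨆ r, MeasurableSpace.comap (N r) inferInstance) ⊔ R)

theorem others_le (h : IsMarkedPoisson R N Z lam eta m2 μ) (i : ℕ) : others R N Z i ≤ mΩ :=
  sup_le (iSup₂_le fun j _ => (h.measurable_mark j).comap_le)
    (sup_le h.comap_count_le h.le_rest)

theorem measurable_count_others (i : ℕ) (r : ℝ≥0) : Measurable[others R N Z i] (N r) := by
  rw [measurable_iff_comap_le]
  exact (le_iSup (fun r => MeasurableSpace.comap (N r) inferInstance) r).trans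
    (le_sup_left.trans le_sup_right)

/-- Before the `i`-th jump, the past does not involve the `i`-th mark. -/
theorem measurableSet_inter_others (hmono : ∀ ω, Monotone fun t => N t ω) {s : ℝ≥0} {i : ℕ}
    {A : Set Ω} (hA : MeasurableSet[past R N Z s] A) :
    MeasurableSet[others R N Z i] (A ∩ {ω | N s ω < i}) := by
  have hE : MeasurableSet[others R N Z i] {ω | N s ω < i} :=
    measurable_count_others i s (measurableSet_Iio (a := i))
  -- Good sets argument: the sets whose trace on {N_s < i} is measurable for `others` form a
  -- σ-algebra, so only the generators of `past` need checking.
  let 𝒯 : MeasurableSpace Ω :=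
    { MeasurableSet' := fun A => MeasurableSet[others R N Z i] (A ∩ {ω | N s ω < i})
      measurableSet_empty := by
        rw [empty_inter]; exact @MeasurableSet.empty _ (others R N Z i)
      measurableSet_compl := fun A hA => by
        have e : Aᶜ ∩ {ω | N s ω < i} = {ω | N s ω < i} \ (A ∩ {ω | N s ω < i}) := by
          ext ω; simp only [mem_inter_iff, mem_compl_iff, mem_sdiff]; tauto
        rw [e]
        exact @MeasurableSet.diff _ (others R N Z i) _ _ hE hA
      measurableSet_iUnion := fun f hf => by
        rw [iUnion_inter]
        exact @MeasurableSet.iUnion _ _ (others R N Z i) _ _ hf }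
  suffices hle : past R N Z s ≤ 𝒯 from hle A hA
  refine sup_le ?_ (iSup₂_le fun r hr => sup_le ?_ ?_)
  · intro A hA
    exact @MeasurableSet.inter _ (others R N Z i) _ _
      ((le_sup_right.trans le_sup_right : R ≤ others R N Z i) _ hA) hE
  · rintro _ ⟨S, hS, rfl⟩
    exact @MeasurableSet.inter _ (others R N Z i) _ _ (measurable_count_others i r hS) hE
  · rintro _ ⟨S, hS, rfl⟩
    -- On {N_s < i} the mark seen at time r ≤ s has index j = N_r < i, so `Z i` never enters.
    have e : (fun ω => Z (N r ω) ω) ⁻¹' S ∩ {ω | N s ω < i} =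
        ⋃ j : ℕ, ⋃ _ : j < i, (Z j ⁻¹' S ∩ (N r ⁻¹' {j} ∩ {ω | N s ω < i})) := by
      ext ω
      simp only [mem_inter_iff, mem_preimage, mem_iUnion, mem_singleton_iff, exists_prop]
      constructor
      · rintro ⟨h1, h2⟩
        exact ⟨N r ω, (hmono ω hr).trans_lt h2, h1, rfl, h2⟩
      · rintro ⟨j, -, h1, rfl, h2⟩
        exact ⟨h1, h2⟩
    change MeasurableSet[others R N Z i] _
    rw [e]
    refine @MeasurableSet.iUnion _ _ (others R N Z i) _ _ fun j =>
      @MeasurableSet.iUnion _ _ (others R N Z i) _ _ fun hj => ?_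
    refine @MeasurableSet.inter _ (others R N Z i) _ _ ?_ (@MeasurableSet.inter _
      (others R N Z i) _ _ (measurable_count_others i r (measurableSet_singleton j)) hE)
    have hle : MeasurableSpace.comap (Z j) inferInstance ≤ others R N Z i :=
      (le_iSup₂ (f := fun j (_ : j ∈ ({i}ᶜ : Set ℕ)) => MeasurableSpace.comap (Z j) inferInstance)
        j hj.ne).trans le_sup_left
    exact hle _ ⟨S, hS, rfl⟩

theorem measurable_indicator_others (hmono : ∀ ω, Monotone fun t => N t ω) {s : ℝ≥0} (T : ℝ≥0)
    (i : ℕ) {Y : Ω → ℝ} (hY : Measurable[past R N Z s] Y) :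
    Measurable[others R N Z i] ({ω | N s ω < i ∧ i ≤ N T ω}.indicator Y) := by
  have h1 : Measurable[others R N Z i] ({ω | N s ω < i}.indicator Y) := by
    intro S hS
    have e : {ω | N s ω < i}.indicator Y ⁻¹' S = (Y ⁻¹' S ∩ {ω | N s ω < i}) ∪
        ({ω | N s ω < i}ᶜ ∩ {_ω | (0 : ℝ) ∈ S}) := by
      ext ω
      by_cases hω : N s ω < i <;> simp [indicator, hω]
    have hE : MeasurableSet[others R N Z i] {ω | N s ω < i} :=
      measurable_count_others i s (measurableSet_Iio (a := i))
    rw [e]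
    refine @MeasurableSet.union _ (others R N Z i) _ _
      (measurableSet_inter_others hmono (hY hS)) ?_
    exact @MeasurableSet.inter _ (others R N Z i) _ _
      (@MeasurableSet.compl _ _ (others R N Z i) hE) (@MeasurableSet.const _ (others R N Z i) _)
  have e : {ω | N s ω < i ∧ i ≤ N T ω}.indicator Y =
      {ω | i ≤ N T ω}.indicator ({ω | N s ω < i}.indicator Y) := by
    rw [indicator_indicator]
    congr 1
    ext ω; exact and_comm
  rw [e]
  have hE : MeasurableSet[others R N Z i] {ω | i ≤ N T ω} :=
    measurable_count_others i T (measurableSet_Ici (a := i))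
  exact @Measurable.indicator _ _ _ _ (others R N Z i) _ _ h1 hE

/-- The mark is independent of the other marks, and the marks jointly are independent of the counts
and `R`; `indep_sup_right` combines the two. -/
theorem indep_mark_others [IsProbabilityMeasure μ] (h : IsMarkedPoisson R N Z lam eta m2 μ)
    (i : ℕ) : Indep (MeasurableSpace.comap (Z i) inferInstance) (others R N Z i) μ := by
  refine indep_sup_right h.comap_mark_le (sup_le h.comap_count_le h.le_rest)
    (le_iSup (fun i => MeasurableSpace.comap (Z i) inferInstance) i)
    (iSup₂_le fun j _ => le_iSup (fun i => MeasurableSpace.comap (Z i) inferInstance) j)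
    ?_ h.indep_right
  have h1 := indep_iSup_of_disjoint (fun i => (h.measurable_mark i).comap_le) h.indep_mark.iIndep
    (S := {i}) (T := {i}ᶜ) disjoint_compl_right
  simpa only [mem_singleton_iff, iSup_iSup_eq_left] using h1

theorem past_le (h : IsMarkedPoisson R N Z lam eta m2 μ) (s : ℝ≥0) : past R N Z s ≤ mΩ :=
  sup_le h.le_rest (iSup₂_le fun r _ => sup_le (h.poisson.measurable r).comap_le
    (Noise.measurable_size (h.poisson.measurable r) h.measurable_mark).comap_le)

/-- The past may be enlarged to the counts up to `s`, all the marks and `R`: the marks and `R` are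
independent of the whole counting process. -/
theorem indep_increment_past [IsProbabilityMeasure μ] (h : IsMarkedPoisson R N Z lam eta m2 μ)
    {s T : ℝ≥0} (hsT : s ≤ T) :
    Indep (MeasurableSpace.comap (fun ω => N T ω - N s ω) inferInstance) (past R N Z s) μ := by
  have hinc : MeasurableSpace.comap (fun ω => N T ω - N s ω) inferInstance ≤
      ⨆ r, MeasurableSpace.comap (N r) inferInstance := by
    have hm : ∀ r, Measurable[⨆ r, MeasurableSpace.comap (N r) inferInstance] (N r) := fun r => by
      rw [measurable_iff_comap_le]
      exact le_iSup (fun r => MeasurableSpace.comap (N r) inferInstance) r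
    rw [← measurable_iff_comap_le]
    exact Measurable.sub (hm T) (hm s)
  have h1 := indep_sup_right h.comap_count_le (sup_le h.comap_mark_le h.le_rest) hinc
    (iSup₂_le fun r (_ : r ≤ s) => le_iSup (fun r => MeasurableSpace.comap (N r) inferInstance) r)
    (h.poisson.indep_increment hsT) h.indep_left
  refine indep_of_indep_of_le_right h1 (sup_le (le_sup_right.trans le_sup_right)
    (iSup₂_le fun r hr => ?_))
  have hNr : MeasurableSpace.comap (N r) inferInstance ≤
      (⨆ r ≤ s, MeasurableSpace.comap (N r) inferInstance) ⊔
        ((⨆ i, MeasurableSpace.comap (Z i) inferInstance) ⊔ R) :=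
    (le_iSup₂ (f := fun r (_ : r ≤ s) => MeasurableSpace.comap (N r) inferInstance) r hr).trans
      le_sup_left
  refine sup_le hNr ?_
  rw [← measurable_iff_comap_le] at hNr ⊢
  refine @Noise.measurable_size _ (_) _ _ hNr fun i => ?_
  rw [measurable_iff_comap_le]
  exact (le_iSup (fun i => MeasurableSpace.comap (Z i) inferInstance) i).trans
    (le_sup_left.trans le_sup_right)

theorem integral_mul_increment [IsProbabilityMeasure μ] (h : IsMarkedPoisson R N Z lam eta m2 μ)
    {s T : ℝ≥0} (hsT : s ≤ T) {Y : Ω → ℝ} (hY : Measurable[past R N Z s] Y) :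
    ∫ ω, Y ω * ((N T ω - N s ω : ℕ) : ℝ) ∂μ = (∫ ω, Y ω ∂μ) * (lam * (T - s)) := by
  have hi : IndepFun Y (fun ω => ((N T ω - N s ω : ℕ) : ℝ)) μ := by
    rw [IndepFun_iff_Indep]
    refine (indep_of_indep_of_le (h.indep_increment_past hsT) ?_ ?_).symm
    · rw [← measurable_iff_comap_le]
      exact (measurable_from_top (f := fun n : ℕ => (n : ℝ))).comp (comap_measurable _)
    · exact measurable_iff_comap_le.1 hY
  rw [hi.integral_fun_mul_eq_mul_integral (hY.mono (h.past_le s) le_rfl).aestronglyMeasurable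
    (h.poisson.integrable_increment hsT).aestronglyMeasurable, h.poisson.integral_increment hsT]

/-- The compensated sum of the jumps after time `s` is orthogonal to the past. -/
theorem integral_mul_jumps [IsProbabilityMeasure μ] (h : IsMarkedPoisson R N Z lam eta m2 μ)
    {s T : ℝ≥0} (hsT : s ≤ T) {Y : Ω → ℝ} (hY : Measurable[past R N Z s] Y)
    (hY2 : MemLp Y 2 μ) :
    ∫ ω, Y ω * ∑ i ∈ Finset.Ioc (N s ω) (N T ω), Z i ω ∂μ =
      eta * (lam * (T - s)) * ∫ ω, Y ω ∂μ := by
  have hYm : Measurable Y := hY.mono (h.past_le s) le_rfl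
  have hs := hasSum_integral_mul_sum_Ioc (h.poisson.measurable s) (h.poisson.measurable T) hYm
    h.measurable_mark (hY2.abs.integrable_mul (h.abs.memLp_integral_sq_jumps hsT).1)
  have hn : MemLp (fun ω => ((N T ω - N s ω : ℕ) : ℝ)) 2 μ :=
    (memLp_two_iff_integrable_sq (h.poisson.integrable_increment hsT).aestronglyMeasurable).2
      (h.poisson.integrable_sq_increment hsT)
  -- The same series with every mark replaced by its mean sums to η E[Y (N_T - N_s)]; the next step
  -- shows that the terms agree.
  have hs' := hasSum_integral_mul_sum_Ioc (h.poisson.measurable s) (h.poisson.measurable T) hYm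
    (z := fun _ _ => eta) (fun _ => measurable_const) (μ := μ) (by
      simp only [Finset.sum_const, Nat.card_Ioc, nsmul_eq_mul]
      exact hY2.abs.integrable_mul (hn.mul_const |eta|))
  have he : ∀ i, ∫ ω, {ω | N s ω < i ∧ i ≤ N T ω}.indicator Y ω * Z i ω ∂μ =
      ∫ ω, {ω | N s ω < i ∧ i ≤ N T ω}.indicator Y ω * eta ∂μ := fun i => by
    have hm := measurable_indicator_others (R := R) (Z := Z) h.poisson.mono T i hY
    have hi : IndepFun ({ω | N s ω < i ∧ i ≤ N T ω}.indicator Y) (Z i) μ := by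
      rw [IndepFun_iff_Indep]
      exact (indep_of_indep_of_le_right (h.indep_mark_others i) (measurable_iff_comap_le.1 hm)).symm
    rw [hi.integral_fun_mul_eq_mul_integral (hm.mono (h.others_le i) le_rfl).aestronglyMeasurable
      (h.measurable_mark i).aestronglyMeasurable, h.mean_mark, integral_mul_const]
  simp only [he] at hs
  rw [hs.unique hs']
  simp only [Finset.sum_const, Nat.card_Ioc, nsmul_eq_mul, ← mul_assoc]
  rw [integral_mul_const, h.integral_mul_increment hsT hY]
  ring

theorem integral_jumps [IsProbabilityMeasure μ] (h : IsMarkedPoisson R N Z lam eta m2 μ)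
    {s T : ℝ≥0} (hsT : s ≤ T) :
    ∫ ω, ∑ i ∈ Finset.Ioc (N s ω) (N T ω), Z i ω ∂μ = eta * (lam * (T - s)) := by
  simpa using h.integral_mul_jumps hsT (Y := fun _ => 1) (@measurable_const _ _ _ (_) _)
    (memLp_const _)

end IsMarkedPoisson

/-- The path properties of a counting process. -/
structure IsCountingPath (n : ℝ≥0 → ℕ) : Prop where
  zero : n 0 = 0
  mono : Monotone n
  right_continuous : ∀ t, ContinuousWithinAt n (Ici t) t
  unit_jumps : ∀ t, 0 < t → ∃ s < t, n t ≤ n s + 1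

theorem IsPoissonProcess.isCountingPath {Ω : Type*} {mΩ : MeasurableSpace Ω} {μ : Measure Ω}
    {N : ℝ≥0 → Ω → ℕ} {lam : ℝ≥0} (hN : IsPoissonProcess N lam μ) (ω : Ω) :
    IsCountingPath fun t => N t ω :=
  ⟨hN.zero ω, hN.mono ω, hN.right_continuous ω, hN.unit_jumps ω⟩

/-! ### Level times of counting paths -/

namespace IsCountingPath

variable {n : ℝ≥0 → ℕ}

theorem exists_const_right (hn : IsCountingPath n) (u : ℝ≥0) :
    ∃ v > u, ∀ r ∈ Ico u v, n r = n u := by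
  have h : ∀ᶠ r in nhdsWithin u (Ici u), n r = n u :=
    hn.right_continuous u (isOpen_discrete {n u} |>.mem_nhds rfl)
  obtain ⟨v, hv, hsub⟩ := (mem_nhdsGE_iff_exists_Ico_subset (a := u)).1 h
  exact ⟨v, hv, fun r hr => hsub hr⟩

/-- For i > 0 take the infimum of the times with n ≥ i. Right-continuity gives n ≥ i there, the unit
jump bound gives n ≤ i, and n 0 = 0 keeps the infimum positive. -/
theorem exists_hit (hn : IsCountingPath n) {s : ℝ≥0} {i : ℕ} (hi : i ≤ n s) :
    ∃ u ≤ s, n u = i := by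
  rcases Nat.eq_zero_or_pos i with rfl | hpos
  · exact ⟨0, zero_le, hn.zero⟩
  let S : Set ℝ≥0 := {u | i ≤ n u}
  have hS : S.Nonempty := ⟨s, hi⟩
  have hlow : ∀ u < sInf S, n u < i := fun u hu => by
    by_contra h
    exact notMem_of_lt_csInf hu (OrderBot.bddBelow S) (not_lt.1 h)
  have hge : i ≤ n (sInf S) := by
    obtain ⟨v, hv, hconst⟩ := hn.exists_const_right (sInf S)
    obtain ⟨u, hu, huv⟩ := exists_lt_of_csInf_lt hS hv
    rw [← hconst u ⟨csInf_le (OrderBot.bddBelow S) hu, huv⟩]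
    exact hu
  have h0 : 0 < sInf S := by
    rw [pos_iff_ne_zero]
    intro h
    rw [h, hn.zero] at hge
    omega
  obtain ⟨v, hv, hjump⟩ := hn.unit_jumps _ h0
  have := hlow v hv
  exact ⟨sInf S, csInf_le (OrderBot.bddBelow S) hi, by omega⟩

/-- One countable set serves all paths: a path is constant just to the right of u, where a dense set
has a point. The time `s` is added because at u = s there is no room on the right. -/
theorem exists_countable_times (s : ℝ≥0) :
    ∃ D : Set ℝ≥0, D.Countable ∧ (∀ r ∈ D, r ≤ s) ∧
      ∀ n : ℝ≥0 → ℕ, IsCountingPath n → ∀ u ≤ s, ∃ r ∈ D, u ≤ r ∧ n r = n u := by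
  obtain ⟨C, hC, hCd⟩ := TopologicalSpace.exists_countable_dense ℝ≥0
  refine ⟨insert s (C ∩ Iic s), (hC.mono inter_subset_left).insert s, ?_, ?_⟩
  · rintro r (rfl | hr)
    · exact le_rfl
    · exact hr.2
  · intro n hn u hu
    rcases hu.eq_or_lt with rfl | hu
    · exact ⟨u, mem_insert _ _, le_rfl, rfl⟩
    · obtain ⟨v, hv, hconst⟩ := hn.exists_const_right u
      obtain ⟨r, hr, hur, hrv⟩ := hCd.exists_between (lt_min hv hu)
      exact ⟨r, Or.inr ⟨hr, (hrv.trans_le (min_le_right _ _)).le⟩, hur.le,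
        hconst r ⟨hur.le, hrv.trans_le (min_le_left _ _)⟩⟩

end IsCountingPath

/-! ### Progressive measurability of the jump sums -/

section Progressive

variable {α Ω : Type*} [MeasurableSpace α] [MeasurableSpace Ω] {N : ℝ≥0 → Ω → ℕ} {s : ℝ≥0}

/-- N_τ ≥ i holds exactly when N_r ≥ i for every r ≥ τ in the countable set, which exhibits the
event as a countable intersection. -/
theorem measurable_count_comp (hN : ∀ ω, IsCountingPath fun t => N t ω)
    (hm : ∀ r ≤ s, Measurable (N r)) {τ : α → ℝ≥0} (hτ : Measurable τ) (hτs : ∀ a, τ a ≤ s) :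
    Measurable fun x : α × Ω => N (τ x.1) x.2 := by
  obtain ⟨D, hD, hDs, hDr⟩ := IsCountingPath.exists_countable_times s
  refine measurable_of_Ici fun i => ?_
  have e : (fun x : α × Ω => N (τ x.1) x.2) ⁻¹' Ici i =
      ⋂ r ∈ D, ((fun x : α × Ω => τ x.1) ⁻¹' (Iic r)ᶜ ∪ (fun x : α × Ω => N r x.2) ⁻¹' Ici i) := by
    ext ⟨a, ω⟩
    simp only [mem_preimage, mem_Ici, mem_iInter, mem_union, mem_compl_iff, mem_Iic]
    constructor
    · intro h r _
      by_cases hr : τ a ≤ r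
      · exact Or.inr (h.trans ((hN ω).mono hr))
      · exact Or.inl hr
    · intro h
      obtain ⟨r, hr, hur, he⟩ := hDr _ (hN ω) _ (hτs a)
      exact he ▸ (h r hr).resolve_left (not_not.2 hur)
  rw [e]
  exact MeasurableSet.biInter hD fun r hr =>
    (hτ.comp measurable_fst measurableSet_Iic.compl).union
      ((hm r (hDs r hr)).comp measurable_snd measurableSet_Ici)

variable {Z : ℕ → Ω → ℝ}

/-- Only the marks Z_{N_r} are observed. Unit jumps ensure that no level is skipped, so if i ≤ N_s
then N_r = i at some r in the countable set, and `Z i` is read off there. -/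
theorem measurable_indicator_mark (hN : ∀ ω, IsCountingPath fun t => N t ω)
    (hm : ∀ r ≤ s, Measurable (N r)) (hZ : ∀ r ≤ s, Measurable fun ω => Z (N r ω) ω) (i : ℕ) :
    Measurable ({ω | i ≤ N s ω}.indicator (Z i)) := by
  obtain ⟨D, hD, hDs, hDr⟩ := IsCountingPath.exists_countable_times s
  intro S hS
  have hE : MeasurableSet {ω | i ≤ N s ω} := hm s le_rfl (measurableSet_Ici (a := i))
  have e : {ω | i ≤ N s ω}.indicator (Z i) ⁻¹' S =
      (⋃ r ∈ D, (N r ⁻¹' {i} ∩ (fun ω => Z (N r ω) ω) ⁻¹' S)) ∪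
        ({ω | i ≤ N s ω}ᶜ ∩ {_ω | (0 : ℝ) ∈ S}) := by
    ext ω
    simp only [mem_preimage, mem_union, mem_iUnion, mem_inter_iff, mem_singleton_iff,
      mem_compl_iff, mem_ofPred_eq, exists_prop]
    by_cases h : i ≤ N s ω
    · rw [indicator_of_mem (by exact h)]
      constructor
      · intro hz
        obtain ⟨u, hu, hui⟩ := (hN ω).exists_hit h
        obtain ⟨r, hr, -, he⟩ := hDr _ (hN ω) u hu
        have he' : N r ω = i := he.trans hui
        exact Or.inl ⟨r, hr, he', by rwa [he']⟩
      · rintro (⟨r, -, rfl, hz⟩ | ⟨h', -⟩)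
        · exact hz
        · exact absurd h h'
    · rw [indicator_of_notMem (by exact h)]
      constructor
      · exact fun h0 => Or.inr ⟨h, h0⟩
      · rintro (⟨r, hr, rfl, -⟩ | ⟨-, h0⟩)
        · exact absurd ((hN ω).mono (hDs r hr)) h
        · exact h0
  rw [e]
  exact (MeasurableSet.biUnion hD fun r hr => (hm r (hDs r hr) (measurableSet_singleton i)).inter
    (hZ r (hDs r hr) hS)).union (hE.compl.inter (MeasurableSet.const _))

theorem measurable_jumps_comp (hN : ∀ ω, IsCountingPath fun t => N t ω)
    (hm : ∀ r ≤ s, Measurable (N r)) (hZ : ∀ r ≤ s, Measurable fun ω => Z (N r ω) ω)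
    {t : ℝ≥0} (hts : t ≤ s) {τ : α → ℝ≥0} (hτ : Measurable τ) (hτs : ∀ a, τ a ≤ s) :
    Measurable fun x : α × Ω => ∑ i ∈ Finset.Ioc (N t x.2) (N (τ x.1) x.2), Z i x.2 := by
  have h1 := (measurable_sum_Ioc (fun i => measurable_indicator_mark hN hm hZ i)).comp
    ((((hm t hts).comp (measurable_snd (α := α))).prodMk
      (measurable_count_comp hN hm hτ hτs)).prodMk measurable_snd)
  convert h1 using 1
  funext x
  refine Finset.sum_congr rfl fun i hi => ?_
  rw [indicator_of_mem]
  exact (Finset.mem_Ioc.1 hi).2.trans ((hN x.2).mono (hτs x.1))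

end Progressive

theorem comap_size_le {Ω : Type*} {A B : MeasurableSpace Ω} {N : Ω → ℕ} {Z : ℕ → Ω → ℝ}
    (hN : MeasurableSpace.comap N inferInstance ≤ A)
    (hZ : ∀ i, MeasurableSpace.comap (Z i) inferInstance ≤ B) :
    MeasurableSpace.comap (fun ω => Z (N ω) ω) inferInstance ≤ A ⊔ B := by
  rw [← measurable_iff_comap_le]
  refine @Noise.measurable_size _ (A ⊔ B) _ _ ?_ fun i => ?_ <;> rw [measurable_iff_comap_le]
  · exact hN.trans le_sup_left
  · exact (hZ i).trans le_sup_right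

theorem measurable_jumps {Ω : Type*} {A B : MeasurableSpace Ω} {N : ℝ≥0 → Ω → ℕ} {Z : ℕ → Ω → ℝ}
    (hN : ∀ r, MeasurableSpace.comap (N r) inferInstance ≤ A)
    (hZ : ∀ i, MeasurableSpace.comap (Z i) inferInstance ≤ B) (s T : ℝ≥0) :
    Measurable[A ⊔ B] fun ω => ∑ i ∈ Finset.Ioc (N s ω) (N T ω), Z i ω := by
  have hN' : ∀ r, Measurable[A ⊔ B] (N r) := fun r =>
    measurable_iff_comap_le.2 ((hN r).trans le_sup_left)
  have hZ' : ∀ i, Measurable[A ⊔ B] (Z i) := fun i =>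
    measurable_iff_comap_le.2 ((hZ i).trans le_sup_right)
  exact (@measurable_sum_Ioc Ω (A ⊔ B) Z hZ').comp
    (Measurable.prodMk (Measurable.prodMk (hN' s) (hN' T)) (@measurable_id Ω (A ⊔ B)))

theorem integral_sub_sq_of_indepFun {Ω : Type*} {mΩ : MeasurableSpace Ω} {μ : Measure Ω}
    {P Q : Ω → ℝ} (hP : MemLp P 2 μ) (hQ : MemLp Q 2 μ) (h : IndepFun P Q μ) :
    ∫ ω, (P ω - Q ω) ^ 2 ∂μ =
      ∫ ω, P ω ^ 2 ∂μ - 2 * ((∫ ω, P ω ∂μ) * ∫ ω, Q ω ∂μ) + ∫ ω, Q ω ^ 2 ∂μ := by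
  have e : ∀ ω, (P ω - Q ω) ^ 2 = P ω ^ 2 - 2 * (P ω * Q ω) + Q ω ^ 2 := fun ω => by ring
  have hPQ : Integrable (fun ω => 2 * (P ω * Q ω)) μ := (hP.integrable_mul hQ).const_mul 2
  simp only [e]
  rw [integral_add (f := fun ω => P ω ^ 2 - 2 * (P ω * Q ω)) (hP.integrable_sq.sub hPQ)
    hQ.integrable_sq, integral_sub hP.integrable_sq hPQ, integral_const_mul,
    h.integral_fun_mul_eq_mul_integral hP.1 hQ.1]

/-! ### The net jumps: mean, variance, orthogonality, measurability -/

namespace Noise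

variable {Ω : Type*} [mΩ : MeasurableSpace Ω] {p : Params} {μ : Measure Ω} (M : Noise p μ)

/-- The σ-algebras generated by the five independent inputs. -/
@[reducible] def inputs : Fin 5 → MeasurableSpace Ω :=
  ![⨆ t, MeasurableSpace.comap (M.W t) inferInstance,
    ⨆ t, MeasurableSpace.comap (M.Np t) inferInstance,
    ⨆ t, MeasurableSpace.comap (M.Nm t) inferInstance,
    ⨆ i, MeasurableSpace.comap (M.Zp i) inferInstance,
    ⨆ i, MeasurableSpace.comap (M.Zm i) inferInstance]

theorem inputs_le (j : Fin 5) : M.inputs j ≤ mΩ := by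
  fin_cases j
  · exact iSup_le fun t => (M.measurable_W t).comap_le
  · exact iSup_le fun t => (M.poisson_p.measurable t).comap_le
  · exact iSup_le fun t => (M.poisson_m.measurable t).comap_le
  · exact iSup_le fun i => (M.measurable_Zp i).comap_le
  · exact iSup_le fun i => (M.measurable_Zm i).comap_le

end Noise

theorem Noise.indep_inputs {Ω : Type*} {A B : MeasurableSpace Ω} [mΩ : MeasurableSpace Ω]
    {p : Params} {μ : Measure Ω} (M : Noise p μ) {S : Set (Fin 5)} (hA : A ≤ ⨆ j ∈ S, M.inputs j)
    (hB : B ≤ ⨆ j ∈ Sᶜ, M.inputs j) : Indep A B μ :=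
  indep_of_indep_of_le
    (indep_iSup_of_disjoint M.inputs_le M.indep (disjoint_compl_right (a := S))) hA hB

namespace Noise

variable {Ω : Type*} [mΩ : MeasurableSpace Ω] {p : Params} {μ : Measure Ω} (M : Noise p μ)

/-- Here `R` consists of the Brownian motion and the whole negative side, including its marks, so
that the full filtration fits into `past`. -/
theorem isMarkedPoisson_pos : IsMarkedPoisson (M.inputs 0 ⊔ (M.inputs 2 ⊔ M.inputs 4))
    M.Np M.Zp p.lam p.eta (∫ ω, M.Zp 1 ω ^ 2 ∂μ) μ where
  poisson := M.poisson_p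
  measurable_mark := M.measurable_Zp
  indep_mark := M.indep_Zp
  ident_mark := M.ident_Zp
  memLp_mark := M.memLp_Zp
  mean_mark := M.mean_Zp
  sq_mark i := ((M.ident_Zp i 1).comp (measurable_id.pow_const 2)).integral_eq
  le_rest := sup_le (M.inputs_le 0) (sup_le (M.inputs_le 2) (M.inputs_le 4))
  indep_left := M.indep_inputs (S := {1}) (le_biSup M.inputs (i := 1) (by simp))
    (sup_le (le_biSup M.inputs (i := 3) (by simp))
      (sup_le (le_biSup M.inputs (i := 0) (by simp))
        (sup_le (le_biSup M.inputs (i := 2) (by simp)) (le_biSup M.inputs (i := 4) (by simp)))))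
  indep_right := M.indep_inputs (S := {3}) (le_biSup M.inputs (i := 3) (by simp))
    (sup_le (le_biSup M.inputs (i := 1) (by simp))
      (sup_le (le_biSup M.inputs (i := 0) (by simp))
        (sup_le (le_biSup M.inputs (i := 2) (by simp)) (le_biSup M.inputs (i := 4) (by simp)))))

theorem isMarkedPoisson_neg : IsMarkedPoisson (M.inputs 0 ⊔ (M.inputs 1 ⊔ M.inputs 3))
    M.Nm M.Zm p.lam p.eta (∫ ω, M.Zm 1 ω ^ 2 ∂μ) μ where
  poisson := M.poisson_m
  measurable_mark := M.measurable_Zm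
  indep_mark := M.indep_Zm
  ident_mark := M.ident_Zm
  memLp_mark := M.memLp_Zm
  mean_mark := M.mean_Zm
  sq_mark i := ((M.ident_Zm i 1).comp (measurable_id.pow_const 2)).integral_eq
  le_rest := sup_le (M.inputs_le 0) (sup_le (M.inputs_le 1) (M.inputs_le 3))
  indep_left := M.indep_inputs (S := {2}) (le_biSup M.inputs (i := 2) (by simp))
    (sup_le (le_biSup M.inputs (i := 4) (by simp))
      (sup_le (le_biSup M.inputs (i := 0) (by simp))
        (sup_le (le_biSup M.inputs (i := 1) (by simp)) (le_biSup M.inputs (i := 3) (by simp)))))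
  indep_right := M.indep_inputs (S := {4}) (le_biSup M.inputs (i := 4) (by simp))
    (sup_le (le_biSup M.inputs (i := 2) (by simp))
      (sup_le (le_biSup M.inputs (i := 0) (by simp))
        (sup_le (le_biSup M.inputs (i := 1) (by simp)) (le_biSup M.inputs (i := 3) (by simp)))))

theorem comap_W_le (s : ℝ≥0) : MeasurableSpace.comap (M.W s) inferInstance ≤ M.inputs 0 :=
  le_iSup (fun s => MeasurableSpace.comap (M.W s) inferInstance) s

theorem comap_Np_le (s : ℝ≥0) : MeasurableSpace.comap (M.Np s) inferInstance ≤ M.inputs 1 :=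
  le_iSup (fun s => MeasurableSpace.comap (M.Np s) inferInstance) s

theorem comap_Nm_le (s : ℝ≥0) : MeasurableSpace.comap (M.Nm s) inferInstance ≤ M.inputs 2 :=
  le_iSup (fun s => MeasurableSpace.comap (M.Nm s) inferInstance) s

theorem comap_Zp_le (i : ℕ) : MeasurableSpace.comap (M.Zp i) inferInstance ≤ M.inputs 3 :=
  le_iSup (fun i => MeasurableSpace.comap (M.Zp i) inferInstance) i

theorem comap_Zm_le (i : ℕ) : MeasurableSpace.comap (M.Zm i) inferInstance ≤ M.inputs 4 :=
  le_iSup (fun i => MeasurableSpace.comap (M.Zm i) inferInstance) i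

theorem filtration_le_past_pos (s : ℝ≥0) : M.filtration s ≤
    IsMarkedPoisson.past (M.inputs 0 ⊔ (M.inputs 2 ⊔ M.inputs 4)) M.Np M.Zp s := by
  refine iSup₂_le fun r hr => ?_
  have h := le_iSup₂ (f := fun r (_ : r ≤ s) => MeasurableSpace.comap (M.Np r) inferInstance ⊔
    MeasurableSpace.comap (fun ω => M.Zp (M.Np r ω) ω) inferInstance) r hr
  refine sup_le (sup_le (sup_le (sup_le ?_ ?_) ?_) ?_) ?_
  · exact (M.comap_W_le r).trans (le_sup_left.trans le_sup_left)
  · exact (le_sup_left.trans h).trans le_sup_right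
  · exact (M.comap_Nm_le r).trans (le_sup_left.trans (le_sup_right.trans le_sup_left))
  · exact (le_sup_right.trans h).trans le_sup_right
  · exact (comap_size_le (M.comap_Nm_le r) M.comap_Zm_le).trans (le_sup_right.trans le_sup_left)

theorem filtration_le_past_neg (s : ℝ≥0) : M.filtration s ≤
    IsMarkedPoisson.past (M.inputs 0 ⊔ (M.inputs 1 ⊔ M.inputs 3)) M.Nm M.Zm s := by
  refine iSup₂_le fun r hr => ?_
  have h := le_iSup₂ (f := fun r (_ : r ≤ s) => MeasurableSpace.comap (M.Nm r) inferInstance ⊔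
    MeasurableSpace.comap (fun ω => M.Zm (M.Nm r ω) ω) inferInstance) r hr
  refine sup_le (sup_le (sup_le (sup_le ?_ ?_) ?_) ?_) ?_
  · exact (M.comap_W_le r).trans (le_sup_left.trans le_sup_left)
  · exact (M.comap_Np_le r).trans (le_sup_left.trans (le_sup_right.trans le_sup_left))
  · exact (le_sup_left.trans h).trans le_sup_right
  · exact (comap_size_le (M.comap_Np_le r) M.comap_Zp_le).trans (le_sup_right.trans le_sup_left)
  · exact (le_sup_right.trans h).trans le_sup_right

theorem filtration_gen_le {r s : ℝ≥0} (hr : r ≤ s) : MeasurableSpace.comap (M.W r) inferInstance ⊔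
    MeasurableSpace.comap (M.Np r) inferInstance ⊔ MeasurableSpace.comap (M.Nm r) inferInstance ⊔
    MeasurableSpace.comap (fun ω => M.Zp (M.Np r ω) ω) inferInstance ⊔
    MeasurableSpace.comap (fun ω => M.Zm (M.Nm r ω) ω) inferInstance ≤ M.filtration s :=
  le_iSup₂ (f := fun r (_ : r ≤ s) => MeasurableSpace.comap (M.W r) inferInstance ⊔
    MeasurableSpace.comap (M.Np r) inferInstance ⊔ MeasurableSpace.comap (M.Nm r) inferInstance ⊔
    MeasurableSpace.comap (fun ω => M.Zp (M.Np r ω) ω) inferInstance ⊔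
    MeasurableSpace.comap (fun ω => M.Zm (M.Nm r ω) ω) inferInstance) r hr

/-- The inventory change between the times `t` and `s` that is due to liquidations. -/
def netJumps (t s : ℝ) (ω : Ω) : ℝ :=
  ∑ i ∈ Finset.Ioc (M.Np t.toNNReal ω) (M.Np s.toNNReal ω), M.Zp i ω -
    ∑ i ∈ Finset.Ioc (M.Nm t.toNNReal ω) (M.Nm s.toNNReal ω), M.Zm i ω

/-- The total size of the liquidations between the times `t` and `s`. -/
def totalJumps (t s : ℝ) (ω : Ω) : ℝ :=
  ∑ i ∈ Finset.Ioc (M.Np t.toNNReal ω) (M.Np s.toNNReal ω), |M.Zp i ω| +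
    ∑ i ∈ Finset.Ioc (M.Nm t.toNNReal ω) (M.Nm s.toNNReal ω), |M.Zm i ω|

theorem inventory_eq (t q : ℝ) (nu : ℝ → Ω → ℝ) (s : ℝ) (ω : Ω) :
    M.inventory t q nu s ω = q - (∫ u in t..s, nu u ω) + M.netJumps t s ω := by
  rw [inventory, netJumps]; ring

theorem abs_netJumps_le {t s T : ℝ} (hsT : s ≤ T) (ω : Ω) :
    |M.netJumps t s ω| ≤ M.totalJumps t T ω := by
  have hp := M.poisson_p.mono ω (Real.toNNReal_le_toNNReal hsT)
  have hm := M.poisson_m.mono ω (Real.toNNReal_le_toNNReal hsT)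
  refine (abs_sub _ _).trans (add_le_add ?_ ?_)
  · exact (Finset.abs_sum_le_sum_abs _ _).trans (Finset.sum_le_sum_of_subset_of_nonneg
      (Finset.Ioc_subset_Ioc_right hp) fun _ _ _ => abs_nonneg _)
  · exact (Finset.abs_sum_le_sum_abs _ _).trans (Finset.sum_le_sum_of_subset_of_nonneg
      (Finset.Ioc_subset_Ioc_right hm) fun _ _ _ => abs_nonneg _)

theorem totalJumps_nonneg (t s : ℝ) (ω : Ω) : 0 ≤ M.totalJumps t s ω :=
  add_nonneg (Finset.sum_nonneg fun _ _ => abs_nonneg _)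
    (Finset.sum_nonneg fun _ _ => abs_nonneg _)

theorem memLp_totalJumps [IsProbabilityMeasure μ] {t T : ℝ} (htT : t ≤ T) :
    MemLp (M.totalJumps t T) 2 μ :=
  (M.isMarkedPoisson_pos.abs.memLp_integral_sq_jumps (Real.toNNReal_le_toNNReal htT)).1.add
    (M.isMarkedPoisson_neg.abs.memLp_integral_sq_jumps (Real.toNNReal_le_toNNReal htT)).1

theorem memLp_netJumps [IsProbabilityMeasure μ] {t T : ℝ} (htT : t ≤ T) :
    MemLp (M.netJumps t T) 2 μ :=
  (M.isMarkedPoisson_pos.memLp_integral_sq_jumps (Real.toNNReal_le_toNNReal htT)).1.sub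
    (M.isMarkedPoisson_neg.memLp_integral_sq_jumps (Real.toNNReal_le_toNNReal htT)).1

theorem netJumps_sub {t s T : ℝ} (hts : t ≤ s) (hsT : s ≤ T) (ω : Ω) :
    M.netJumps t T ω - M.netJumps t s ω = M.netJumps s T ω := by
  have hp := Finset.sum_Ioc_consecutive (fun i => M.Zp i ω)
    (M.poisson_p.mono ω (Real.toNNReal_le_toNNReal hts))
    (M.poisson_p.mono ω (Real.toNNReal_le_toNNReal hsT))
  have hm := Finset.sum_Ioc_consecutive (fun i => M.Zm i ω)
    (M.poisson_m.mono ω (Real.toNNReal_le_toNNReal hts))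
    (M.poisson_m.mono ω (Real.toNNReal_le_toNNReal hsT))
  simp only [netJumps]
  simp only at hp hm
  linarith

/-- Both sides contribute η λ (T - s) E[Y], so the compensators cancel. -/
theorem integral_mul_netJumps [IsProbabilityMeasure μ] {s T : ℝ} (hsT : s ≤ T) {Y : Ω → ℝ}
    (hY : Measurable[M.filtration s.toNNReal] Y) (hY2 : MemLp Y 2 μ) :
    ∫ ω, Y ω * M.netJumps s T ω ∂μ = 0 := by
  have hsT' := Real.toNNReal_le_toNNReal hsT
  have hp := M.isMarkedPoisson_pos.integral_mul_jumps hsT'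
    (hY.mono (M.filtration_le_past_pos _) le_rfl) hY2
  have hm := M.isMarkedPoisson_neg.integral_mul_jumps hsT'
    (hY.mono (M.filtration_le_past_neg _) le_rfl) hY2
  simp only [netJumps, mul_sub]
  rw [integral_sub, hp, hm, sub_self]
  · exact hY2.integrable_mul (M.isMarkedPoisson_pos.memLp_integral_sq_jumps hsT').1
  · exact hY2.integrable_mul (M.isMarkedPoisson_neg.memLp_integral_sq_jumps hsT').1

theorem integral_netJumps [IsProbabilityMeasure μ] {s T : ℝ} (hsT : s ≤ T) :
    ∫ ω, M.netJumps s T ω ∂μ = 0 := by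
  simpa using M.integral_mul_netJumps hsT (Y := fun _ => 1) (@measurable_const _ _ _ (_) _)
    (memLp_const _)

/-- The two squared means cancel against twice the product of the equal means, leaving only the
second moments of the sizes. -/
theorem integral_sq_netJumps [IsProbabilityMeasure μ] {s T : ℝ} (hs : 0 ≤ s) (hsT : s ≤ T) :
    ∫ ω, M.netJumps s T ω ^ 2 ∂μ = 2 * p.lam * M.secondMoment * (T - s) := by
  have hsT' := Real.toNNReal_le_toNNReal hsT
  obtain ⟨hp, hp2⟩ := M.isMarkedPoisson_pos.memLp_integral_sq_jumps hsT'
  obtain ⟨hm, hm2⟩ := M.isMarkedPoisson_neg.memLp_integral_sq_jumps hsT'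
  have hind : IndepFun
      (fun ω => ∑ i ∈ Finset.Ioc (M.Np s.toNNReal ω) (M.Np T.toNNReal ω), M.Zp i ω)
      (fun ω => ∑ i ∈ Finset.Ioc (M.Nm s.toNNReal ω) (M.Nm T.toNNReal ω), M.Zm i ω) μ := by
    rw [IndepFun_iff_Indep]
    refine M.indep_inputs (S := {1, 3}) ?_ ?_
    · exact (measurable_iff_comap_le.1
        (measurable_jumps M.comap_Np_le M.comap_Zp_le s.toNNReal T.toNNReal)).trans
        (sup_le (le_biSup M.inputs (i := 1) (by simp)) (le_biSup M.inputs (i := 3) (by simp)))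
    · exact (measurable_iff_comap_le.1
        (measurable_jumps M.comap_Nm_le M.comap_Zm_le s.toNNReal T.toNNReal)).trans
        (sup_le (le_biSup M.inputs (i := 2) (by simp)) (le_biSup M.inputs (i := 4) (by simp)))
  refine (integral_sub_sq_of_indepFun hp hm hind).trans ?_
  rw [hp2, hm2, M.isMarkedPoisson_pos.integral_jumps hsT',
    M.isMarkedPoisson_neg.integral_jumps hsT', secondMoment,
    Real.coe_toNNReal _ hs, Real.coe_toNNReal _ (hs.trans hsT)]
  ring

/-- The net jumps are progressively measurable. -/
theorem measurable_netJumps_comp {α : Type*} [MeasurableSpace α] {t s : ℝ} (hts : t ≤ s)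
    {τ : α → ℝ} (hτ : Measurable τ) (hτs : ∀ a, τ a ≤ s) :
    Measurable[(inferInstance : MeasurableSpace α).prod (M.filtration s.toNNReal)]
      fun x : α × Ω => M.netJumps t (τ x.1) x.2 := by
  have hp := @measurable_jumps_comp α Ω _ (M.filtration s.toNNReal) M.Np s.toNNReal M.Zp
    M.poisson_p.isCountingPath
    (fun r hr => measurable_iff_comap_le.2 (((le_sup_right.trans le_sup_left).trans
      (le_sup_left.trans le_sup_left)).trans (M.filtration_gen_le hr)))
    (fun r hr => measurable_iff_comap_le.2 ((le_sup_right.trans le_sup_left).trans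
      (M.filtration_gen_le hr))) _ (Real.toNNReal_le_toNNReal hts) _
    hτ.real_toNNReal (fun a => Real.toNNReal_le_toNNReal (hτs a))
  have hm := @measurable_jumps_comp α Ω _ (M.filtration s.toNNReal) M.Nm s.toNNReal M.Zm
    M.poisson_m.isCountingPath
    (fun r hr => measurable_iff_comap_le.2 ((le_sup_right.trans
      (le_sup_left.trans le_sup_left)).trans (M.filtration_gen_le hr)))
    (fun r hr => measurable_iff_comap_le.2 (le_sup_right.trans
      (M.filtration_gen_le hr))) _ (Real.toNNReal_le_toNNReal hts) _
    hτ.real_toNNReal (fun a => Real.toNNReal_le_toNNReal (hτs a))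
  exact Measurable.sub hp hm

end Noise

/-! ### Pathwise product rules for the drift -/

section Pathwise

/-- Controls are merely integrable in time, so the drift is differentiable only almost everywhere;
absolute continuity still gives the fundamental theorem of calculus. -/
theorem integral_eq_sub_of_absolutelyContinuous {F F' : ℝ → ℝ} {a b : ℝ}
    (hF : AbsolutelyContinuousOnInterval F a b)
    (hF' : ∀ᵐ x, x ∈ uIcc a b → HasDerivAt F (F' x) x) :
    ∫ x in a..b, F' x = F b - F a := by
  rw [← hF.integral_deriv_eq_sub]
  refine intervalIntegral.integral_congr_ae ?_
  filter_upwards [hF'] with x hx hxm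
  exact (hx (uIoc_subset_uIcc hxm)).deriv.symm

theorem absolutelyContinuous_sub_integral {v : ℝ → ℝ} {t T : ℝ}
    (hv : IntervalIntegrable v volume t T) (q : ℝ) :
    AbsolutelyContinuousOnInterval (fun s => q - ∫ u in t..s, v u) t T :=
  (LipschitzWith.const' (K := 0) q).lipschitzOnWith.absolutelyContinuousOnInterval.sub
    (hv.absolutelyContinuousOnInterval_intervalIntegral left_mem_uIcc)

theorem ae_hasDerivAt_sub_integral {v : ℝ → ℝ} {t T : ℝ}
    (hv : IntervalIntegrable v volume t T) (q : ℝ) :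
    ∀ᵐ x, x ∈ uIcc t T → HasDerivAt (fun s => q - ∫ u in t..s, v u) (-v x) x := by
  filter_upwards [hv.ae_hasDerivAt_integral] with x hx hxm
  exact (hx hxm t left_mem_uIcc).const_sub q

variable {f f' v : ℝ → ℝ} {t T : ℝ}

/-- Product rule for `f(s) B(s)` with `B(s) = q - ∫_t^s v`. -/
theorem integral_deriv_mul_sub_integral (htT : t ≤ T) (hf : ContDiffOn ℝ 1 f (Icc t T))
    (hf' : ∀ s ∈ Icc t T, HasDerivAt f (f' s) s) (hv : IntervalIntegrable v volume t T) (q : ℝ) :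
    f T * (q - ∫ u in t..T, v u) = f t * q +
      ∫ s in t..T, (f' s * (q - ∫ u in t..s, v u) - f s * v s) := by
  rw [← uIcc_of_le htT] at hf hf'
  have h := integral_eq_sub_of_absolutelyContinuous
    (F' := fun s => f' s * (q - ∫ u in t..s, v u) - f s * v s)
    (hf.absolutelyContinuousOnInterval.fun_mul (absolutelyContinuous_sub_integral hv q)) (by
      filter_upwards [ae_hasDerivAt_sub_integral hv q] with x hx hxm
      refine ((hf' x hxm).mul (hx hxm)).congr_deriv ?_
      ring)
  rw [h]
  simp

/-- Product rule for `f(s) B(s)²` with `B(s) = q - ∫_t^s v`. -/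
theorem integral_deriv_mul_sq_sub_integral (htT : t ≤ T) (hf : ContDiffOn ℝ 1 f (Icc t T))
    (hf' : ∀ s ∈ Icc t T, HasDerivAt f (f' s) s) (hv : IntervalIntegrable v volume t T) (q : ℝ) :
    f T * (q - ∫ u in t..T, v u) ^ 2 = f t * q ^ 2 +
      ∫ s in t..T, (f' s * (q - ∫ u in t..s, v u) ^ 2 -
        2 * f s * (q - ∫ u in t..s, v u) * v s) := by
  rw [← uIcc_of_le htT] at hf hf'
  have hB := absolutelyContinuous_sub_integral hv q
  have h := integral_eq_sub_of_absolutelyContinuous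
    (F' := fun s => f' s * (q - ∫ u in t..s, v u) ^ 2 -
        2 * f s * (q - ∫ u in t..s, v u) * v s)
    (hf.absolutelyContinuousOnInterval.fun_mul (hB.fun_mul hB)) (by
      filter_upwards [ae_hasDerivAt_sub_integral hv q] with x hx hxm
      refine ((hf' x hxm).mul ((hx hxm).mul (hx hxm))).congr_deriv ?_
      simp only [Pi.mul_apply]
      ring)
  rw [h]
  simp only [intervalIntegral.integral_same]
  ring

/-- Cauchy–Schwarz, from expanding ∫((T - t)|v| - K)² ≥ 0 with K = ∫|v|. -/
theorem sq_integral_abs_le (htT : t ≤ T) (h1 : Integrable v (volume.restrict (Icc t T)))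
    (h2 : Integrable (fun s => v s ^ 2) (volume.restrict (Icc t T))) :
    (∫ s in Icc t T, |v s|) ^ 2 ≤ (T - t) * ∫ s in Icc t T, v s ^ 2 := by
  rcases htT.eq_or_lt with rfl | hlt
  · simp
  set K := ∫ s in Icc t T, |v s|
  have h0 : 0 ≤ ∫ s in Icc t T, ((T - t) * |v s| - K) ^ 2 :=
    integral_nonneg fun s => sq_nonneg _
  have e : ∀ s, ((T - t) * |v s| - K) ^ 2 =
      (T - t) ^ 2 * v s ^ 2 - 2 * (T - t) * K * |v s| + K ^ 2 := fun s => by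
    rw [← sq_abs (v s)]; ring
  simp only [e] at h0
  rw [integral_add (f := fun s => (T - t) ^ 2 * v s ^ 2 - 2 * (T - t) * K * |v s|)
    ((h2.const_mul _).sub (h1.abs.const_mul _)) (integrable_const _),
    integral_sub (h2.const_mul _) (h1.abs.const_mul _), integral_const_mul, integral_const_mul,
    integral_const] at h0
  simp only [MeasurableSet.univ, measureReal_restrict_apply, univ_inter, Real.volume_real_Icc_of_le
    htT, smul_eq_mul] at h0
  have h3 : 0 ≤ (T - t) * ((T - t) * (∫ s in Icc t T, v s ^ 2) - K ^ 2) := by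
    have : ∫ s in Icc t T, |v s| = K := rfl
    rw [this] at h0
    linarith
  have := nonneg_of_mul_nonneg_right h3 (sub_pos.2 hlt)
  linarith

end Pathwise

/-- A moving endpoint becomes the indicator of a measurable set in the product space; the two sets
below account for the two orientations of the interval. -/
theorem measurable_intervalIntegral_prod {Ω : Type*} [MeasurableSpace Ω] {f : ℝ → Ω → ℝ}
    (hf : Measurable (Function.uncurry f)) (t : ℝ) :
    Measurable fun z : ℝ × Ω => ∫ u in t..z.1, f u z.2 := by
  have h1 : ∀ S : Set ((ℝ × Ω) × ℝ), MeasurableSet S →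
      Measurable fun z : ℝ × Ω => ∫ u, S.indicator (fun w => f w.2 w.1.2) (z, u) := fun S hS => by
    refine (StronglyMeasurable.integral_prod_right' (f := S.indicator (fun w => f w.2 w.1.2))
      (Measurable.stronglyMeasurable (Measurable.indicator ?_ hS))).measurable
    exact hf.comp (measurable_snd.prodMk (measurable_snd.comp measurable_fst))
  have h2 := (h1 {w | t < w.2 ∧ w.2 ≤ w.1.1} ((measurableSet_lt measurable_const
    measurable_snd).inter (measurableSet_le measurable_snd (measurable_fst.comp
    measurable_fst)))).sub (h1 {w | w.1.1 < w.2 ∧ w.2 ≤ t} ((measurableSet_lt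
    (measurable_fst.comp measurable_fst) measurable_snd).inter
    (measurableSet_le measurable_snd measurable_const)))
  convert h2 using 1
  funext z
  simp only [intervalIntegral, ← integral_indicator measurableSet_Ioc]
  rfl

/-! ### Square integrability of the control and the drift -/

section Verification

variable {Ω : Type*} [MeasurableSpace Ω] {μ : Measure Ω} {t T : ℝ} {nu X : ℝ → Ω → ℝ} {D : Ω → ℝ}

theorem ae_mem_Icc_prod : ∀ᵐ z ∂(volume.restrict (Icc t T)).prod μ, z.1 ∈ Icc t T :=
  Measure.quasiMeasurePreserving_fst.ae (ae_restrict_mem measurableSet_Icc)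

theorem memLp_mul_continuousOn {a : ℝ → ℝ} (ha : ContinuousOn a (Icc t T)) {g : ℝ × Ω → ℝ}
    (hg : MemLp g 2 ((volume.restrict (Icc t T)).prod μ)) :
    MemLp (fun z => a z.1 * g z) 2 ((volume.restrict (Icc t T)).prod μ) := by
  obtain ⟨C, hC⟩ := isCompact_Icc.exists_bound_of_continuousOn ha
  refine hg.of_le_mul (c := C) ?_ ?_
  · exact ((ha.aestronglyMeasurable measurableSet_Icc).comp_quasiMeasurePreserving
      Measure.quasiMeasurePreserving_fst).mul hg.1
  · filter_upwards [ae_mem_Icc_prod] with z hz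
    rw [norm_mul]
    exact mul_le_mul_of_nonneg_right (hC _ hz) (norm_nonneg _)

variable [IsProbabilityMeasure μ]

theorem memLp_control (hnu : Measurable (Function.uncurry nu))
    (h2 : ∫⁻ ω, (∫⁻ s in Icc t T, ‖nu s ω‖ₑ ^ 2) ∂μ < ∞) :
    MemLp (Function.uncurry nu) 2 ((volume.restrict (Icc t T)).prod μ) := by
  refine ⟨hnu.aestronglyMeasurable, ?_⟩
  rw [eLpNorm_lt_top_iff_lintegral_rpow_enorm_lt_top two_ne_zero ENNReal.ofNat_ne_top,
    lintegral_prod_symm _ (by fun_prop)]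
  simpa using h2

theorem memLp_integral_abs (htT : t ≤ T) (hnu : Measurable (Function.uncurry nu))
    (h2 : MemLp (Function.uncurry nu) 2 ((volume.restrict (Icc t T)).prod μ)) :
    MemLp (fun ω => ∫ s in Icc t T, |nu s ω|) 2 μ := by
  have hm : AEStronglyMeasurable (fun ω => ∫ s in Icc t T, |nu s ω|) μ :=
    (StronglyMeasurable.integral_prod_left' (f := fun z : ℝ × Ω => |nu z.1 z.2|)
      hnu.abs.stronglyMeasurable).aestronglyMeasurable
  rw [memLp_two_iff_integrable_sq hm]
  refine (h2.integrable_sq.integral_prod_right.const_mul (T - t)).mono' (hm.pow 2) ?_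
  filter_upwards [(h2.integrable one_le_two).prod_left_ae, h2.integrable_sq.prod_left_ae]
    with ω h3 h4
  rw [Real.norm_of_nonneg (sq_nonneg _)]
  exact sq_integral_abs_le htT h3 h4

theorem ae_intervalIntegrable (htT : t ≤ T)
    (h2 : MemLp (Function.uncurry nu) 2 ((volume.restrict (Icc t T)).prod μ)) :
    ∀ᵐ ω ∂μ, IntervalIntegrable (fun s => nu s ω) volume t T := by
  filter_upwards [(h2.integrable one_le_two).prod_left_ae] with ω h
  rw [intervalIntegrable_iff_integrableOn_Icc_of_le htT]
  exact h

theorem abs_sub_integral_le {v : ℝ → ℝ} (hv : Integrable v (volume.restrict (Icc t T))) {s : ℝ}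
    (hs : s ∈ Icc t T) (q : ℝ) :
    |q - ∫ u in t..s, v u| ≤ |q| + ∫ u in Icc t T, |v u| := by
  refine (abs_sub _ _).trans (add_le_add_right ?_ _)
  rw [intervalIntegral.integral_of_le hs.1]
  refine abs_integral_le_integral_abs.trans
    (setIntegral_mono_set hv.abs (Filter.Eventually.of_forall fun _ => abs_nonneg _) ?_)
  exact (Ioc_subset_Icc_self.trans (Icc_subset_Icc_right hs.2)).eventuallyLE

theorem memLp_sub_integral_prod (htT : t ≤ T) (hnu : Measurable (Function.uncurry nu))
    (h2 : MemLp (Function.uncurry nu) 2 ((volume.restrict (Icc t T)).prod μ)) (q : ℝ) :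
    MemLp (fun z : ℝ × Ω => q - ∫ u in t..z.1, nu u z.2) 2
      ((volume.restrict (Icc t T)).prod μ) := by
  have hK := ((memLp_const |q|).add (memLp_integral_abs htT hnu h2)).comp_snd
    (volume.restrict (Icc t T))
  refine hK.mono (measurable_const.sub
    (measurable_intervalIntegral_prod hnu t)).aestronglyMeasurable ?_
  have h3 : ∀ᵐ z ∂(volume.restrict (Icc t T)).prod μ,
      Integrable (fun s => nu s z.2) (volume.restrict (Icc t T)) :=
    Measure.quasiMeasurePreserving_snd.ae (h2.integrable one_le_two).prod_left_ae
  filter_upwards [h3, ae_mem_Icc_prod] with z h3 hz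
  exact (abs_sub_integral_le h3 hz q).trans (le_abs_self _)

theorem memLp_sub_integral (htT : t ≤ T) (hnu : Measurable (Function.uncurry nu))
    (h2 : MemLp (Function.uncurry nu) 2 ((volume.restrict (Icc t T)).prod μ)) (q : ℝ) {s : ℝ}
    (hs : s ∈ Icc t T) : MemLp (fun ω => q - ∫ u in t..s, nu u ω) 2 μ := by
  refine ((memLp_const |q|).add (memLp_integral_abs htT hnu h2)).mono (measurable_const.sub
    ((measurable_intervalIntegral_prod hnu t).comp measurable_prodMk_left)).aestronglyMeasurable ?_
  filter_upwards [(h2.integrable one_le_two).prod_left_ae] with ω h3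
  exact (abs_sub_integral_le h3 hs q).trans (le_abs_self _)

theorem memLp_of_dominated (hX : AEStronglyMeasurable (Function.uncurry X)
      ((volume.restrict (Icc t T)).prod μ))
    (hXD : ∀ s ∈ Icc t T, ∀ ω, |X s ω| ≤ D ω) (hD : MemLp D 2 μ) :
    MemLp (Function.uncurry X) 2 ((volume.restrict (Icc t T)).prod μ) := by
  refine (hD.comp_snd (volume.restrict (Icc t T))).mono hX ?_
  filter_upwards [ae_mem_Icc_prod] with z hz
  exact (hXD z.1 hz z.2).trans (le_abs_self _)

end Verification

/-! ### Dynkin's formula for a quadratic function of the state -/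

theorem integral_add_two_mul_add {α : Type*} [MeasurableSpace α] {μ : Measure α} {a b c : α → ℝ}
    (ha : Integrable a μ) (hb : Integrable b μ) (hc : Integrable c μ) :
    ∫ x, (a x + 2 * b x + c x) ∂μ = ∫ x, a x ∂μ + 2 * ∫ x, b x ∂μ + ∫ x, c x ∂μ := by
  rw [integral_add (f := fun x => a x + 2 * b x) (ha.add (hb.const_mul 2)) hc,
    integral_add ha (hb.const_mul 2), integral_const_mul]

theorem integral_mul_sub_mul {α : Type*} [MeasurableSpace α] {μ : Measure α} {a b : α → ℝ}
    (ha : Integrable a μ) (hb : Integrable b μ) (x y : ℝ) :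
    ∫ z, (x * a z - y * b z) ∂μ = x * ∫ z, a z ∂μ - y * ∫ z, b z ∂μ := by
  rw [integral_sub (ha.const_mul x) (hb.const_mul y), integral_const_mul, integral_const_mul]

/-- Dynkin's formula for `f(s) Q_s²`, where `Q = q - ∫ ν + X` and `X` is a square integrable process
with orthogonal increments and variance growing at rate `c`. -/
theorem integral_mul_sq_state {Ω : Type*} [MeasurableSpace Ω] {μ : Measure Ω}
    [IsProbabilityMeasure μ] {t T : ℝ} {nu X : ℝ → Ω → ℝ} {D : Ω → ℝ} {f f' : ℝ → ℝ}
    (htT : t ≤ T) (hf : ContDiffOn ℝ 1 f (Icc t T))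
    (hf' : ∀ s ∈ Icc t T, HasDerivAt f (f' s) s) (hf'c : ContinuousOn f' (Icc t T))
    (hnu : Measurable (Function.uncurry nu))
    (hnu2 : MemLp (Function.uncurry nu) 2 ((volume.restrict (Icc t T)).prod μ))
    (hX : AEStronglyMeasurable (Function.uncurry X) ((volume.restrict (Icc t T)).prod μ))
    (hX2 : ∀ s ∈ Icc t T, MemLp (X s) 2 μ)
    (hXD : ∀ s ∈ Icc t T, ∀ ω, |X s ω| ≤ D ω) (hD : MemLp D 2 μ)
    (hX0 : ∫ ω, X T ω ∂μ = 0) {c : ℝ} (hXc : ∀ s ∈ Icc t T, ∫ ω, X s ω ^ 2 ∂μ = c * (s - t))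
    (q : ℝ)
    (hnuX : ∀ᵐ s ∂volume.restrict (Icc t T),
      ∫ ω, nu s ω * X T ω ∂μ = ∫ ω, nu s ω * X s ω ∂μ)
    (hBX : ∀ᵐ s ∂volume.restrict (Icc t T),
      ∫ ω, (q - ∫ u in t..s, nu u ω) * X T ω ∂μ = ∫ ω, (q - ∫ u in t..s, nu u ω) * X s ω ∂μ) :
    ∫ ω, f T * (q - (∫ u in t..T, nu u ω) + X T ω) ^ 2 ∂μ =
      f t * q ^ 2 + ∫ z, (f' z.1 * (q - (∫ u in t..z.1, nu u z.2) + X z.1 z.2) ^ 2 -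
        2 * f z.1 * (q - (∫ u in t..z.1, nu u z.2) + X z.1 z.2) * nu z.1 z.2)
          ∂(volume.restrict (Icc t T)).prod μ + c * ∫ s in Icc t T, f s := by
  set P := (volume.restrict (Icc t T)).prod μ
  set B : ℝ → Ω → ℝ := fun s ω => q - ∫ u in t..s, nu u ω with hB
  have hTm : T ∈ Icc t T := right_mem_Icc.2 htT
  have hBP : MemLp (fun z : ℝ × Ω => B z.1 z.2) 2 P := memLp_sub_integral_prod htT hnu hnu2 q
  have hXP : MemLp (fun z : ℝ × Ω => X z.1 z.2) 2 P := memLp_of_dominated hX hXD hD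
  have hNP : MemLp (fun z : ℝ × Ω => nu z.1 z.2) 2 P := hnu2
  have hXTP : MemLp (fun z : ℝ × Ω => X T z.2) 2 P := (hX2 T hTm).comp_snd _
  have hBT : MemLp (B T) 2 μ := memLp_sub_integral htT hnu hnu2 q hTm
  have hfB : MemLp (fun z : ℝ × Ω => f' z.1 * B z.1 z.2 - f z.1 * nu z.1 z.2) 2 P :=
    (memLp_mul_continuousOn hf'c hBP).sub (memLp_mul_continuousOn hf.continuousOn hNP)
  have hpath1 : ∀ᵐ ω ∂μ, f T * B T ω ^ 2 = f t * q ^ 2 +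
      ∫ s in Icc t T, (f' s * B s ω ^ 2 - 2 * f s * B s ω * nu s ω) := by
    filter_upwards [ae_intervalIntegrable htT hnu2] with ω hω
    rw [integral_Icc_eq_integral_Ioc, ← intervalIntegral.integral_of_le htT]
    exact integral_deriv_mul_sq_sub_integral htT hf hf' hω q
  have hpath2 : ∀ᵐ ω ∂μ, f T * B T ω = f t * q +
      ∫ s in Icc t T, (f' s * B s ω - f s * nu s ω) := by
    filter_upwards [ae_intervalIntegrable htT hnu2] with ω hω
    rw [integral_Icc_eq_integral_Ioc, ← intervalIntegral.integral_of_le htT]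
    exact integral_deriv_mul_sub_integral htT hf hf' hω q
  -- the square of the drift part
  have hi1 : Integrable (fun z : ℝ × Ω => f' z.1 * B z.1 z.2 ^ 2 -
      2 * f z.1 * B z.1 z.2 * nu z.1 z.2) P := by
    have h := ((memLp_mul_continuousOn hf'c hBP).integrable_mul hBP).sub
      (((memLp_mul_continuousOn hf.continuousOn hBP).integrable_mul hNP).const_mul 2)
    refine h.congr (Filter.Eventually.of_forall fun z => ?_)
    simp only [Pi.sub_apply, Pi.mul_apply]
    ring
  have hE1 : ∫ ω, f T * B T ω ^ 2 ∂μ = f t * q ^ 2 +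
      ∫ z, (f' z.1 * B z.1 z.2 ^ 2 - 2 * f z.1 * B z.1 z.2 * nu z.1 z.2) ∂P := by
    rw [integral_congr_ae hpath1, integral_add (integrable_const _) hi1.integral_prod_right,
      integral_const, integral_prod_symm _ hi1]
    simp
  -- the mixed term
  have hi2 : Integrable (fun z : ℝ × Ω =>
      (f' z.1 * B z.1 z.2 - f z.1 * nu z.1 z.2) * X T z.2) P := hfB.integrable_mul hXTP
  have hi3 : Integrable (fun z : ℝ × Ω =>
      (f' z.1 * B z.1 z.2 - f z.1 * nu z.1 z.2) * X z.1 z.2) P := hfB.integrable_mul hXP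
  have hE2 : ∫ ω, f T * B T ω * X T ω ∂μ =
      ∫ z, (f' z.1 * B z.1 z.2 - f z.1 * nu z.1 z.2) * X z.1 z.2 ∂P := by
    have e1 : ∀ᵐ ω ∂μ, f T * B T ω * X T ω = f t * q * X T ω +
        ∫ s in Icc t T, (f' s * B s ω - f s * nu s ω) * X T ω := by
      filter_upwards [hpath2] with ω hω
      rw [hω, integral_mul_const, add_mul]
    -- At each fixed s, outside a null set, the orthogonality hypotheses replace X_T by X_s against
    -- both `B s` and `nu s`.
    have e2 : ∫ z, (f' z.1 * B z.1 z.2 - f z.1 * nu z.1 z.2) * X T z.2 ∂P =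
        ∫ z, (f' z.1 * B z.1 z.2 - f z.1 * nu z.1 z.2) * X z.1 z.2 ∂P := by
      rw [integral_prod _ hi2, integral_prod _ hi3]
      refine integral_congr_ae ?_
      filter_upwards [hnuX, hBX, ae_restrict_mem measurableSet_Icc,
        (hNP.integrable_mul hXTP).prod_right_ae, (hNP.integrable_mul hXP).prod_right_ae]
        with s h1 h2 hs h3 h4
      have hBs : MemLp (B s) 2 μ := memLp_sub_integral htT hnu hnu2 q hs
      have e3 : ∀ x : ℝ → Ω → ℝ, ∀ r, (fun ω => (f' s * B s ω - f s * nu s ω) * x r ω) =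
          fun ω => f' s * (B s ω * x r ω) - f s * (nu s ω * x r ω) := fun x r => by
        funext ω; ring
      change ∫ ω, (f' s * B s ω - f s * nu s ω) * X T ω ∂μ =
        ∫ ω, (f' s * B s ω - f s * nu s ω) * X s ω ∂μ
      rw [e3, e3]
      refine (integral_mul_sub_mul (hBs.integrable_mul (hX2 T hTm)) h3 _ _).trans
        (Eq.trans ?_ (integral_mul_sub_mul (hBs.integrable_mul (hX2 s hs)) h4 _ _).symm)
      simp only [Pi.mul_apply]
      rw [h1, h2]
    rw [integral_congr_ae e1, integral_add (((hX2 T hTm).integrable one_le_two).const_mul _)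
      hi2.integral_prod_right, integral_const_mul, hX0, mul_zero, zero_add, ← e2,
      integral_prod_symm _ hi2]
  -- the square of the jump part
  have hi4 : Integrable (fun z : ℝ × Ω => f' z.1 * X z.1 z.2 ^ 2) P := by
    refine ((memLp_mul_continuousOn hf'c hXP).integrable_mul hXP).congr
      (Filter.Eventually.of_forall fun z => ?_)
    simp only [Pi.mul_apply]
    ring
  have hE3 : ∫ ω, f T * X T ω ^ 2 ∂μ =
      ∫ z, f' z.1 * X z.1 z.2 ^ 2 ∂P + c * ∫ s in Icc t T, f s := by
    have hint1 : IntegrableOn (fun s => f' s * (s - t)) (Icc t T) :=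
      (hf'c.mul (by fun_prop)).integrableOn_Icc
    have hint2 : IntegrableOn f (Icc t T) := hf.continuousOn.integrableOn_Icc
    have e1 : ∫ z, f' z.1 * X z.1 z.2 ^ 2 ∂P = c * ∫ s in Icc t T, f' s * (s - t) := by
      rw [integral_prod _ hi4, ← integral_const_mul]
      refine setIntegral_congr_fun measurableSet_Icc fun s hs => ?_
      simp only
      rw [integral_const_mul, hXc s hs]
      ring
    -- Integration by parts for f(s)(s - t), the variance profile up to the factor `c`.
    have e2 : (∫ s in Icc t T, f' s * (s - t)) + ∫ s in Icc t T, f s = f T * (T - t) := by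
      rw [← integral_add hint1 hint2, integral_Icc_eq_integral_Ioc,
        ← intervalIntegral.integral_of_le htT]
      rw [intervalIntegral.integral_eq_sub_of_hasDerivAt (f := fun s => f s * (s - t))]
      · simp
      · intro s hs
        rw [uIcc_of_le htT] at hs
        refine ((hf' s hs).mul ((hasDerivAt_id s).sub_const t)).congr_deriv ?_
        simp
      · rw [intervalIntegrable_iff_integrableOn_Icc_of_le htT]
        exact hint1.add hint2
    rw [integral_const_mul, hXc T hTm, e1]
    linear_combination -c * e2
  have hsplit : ∀ ω, f T * (B T ω + X T ω) ^ 2 =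
      f T * B T ω ^ 2 + 2 * (f T * B T ω * X T ω) + f T * X T ω ^ 2 := fun ω => by ring
  have hj1 : Integrable (fun ω => f T * B T ω ^ 2) μ := hBT.integrable_sq.const_mul _
  have hj2 : Integrable (fun ω => f T * B T ω * X T ω) μ :=
    (hBT.const_mul (f T)).integrable_mul (hX2 T hTm)
  have hj3 : Integrable (fun ω => f T * X T ω ^ 2) μ := (hX2 T hTm).integrable_sq.const_mul _
  have hL : ∫ ω, f T * (B T ω + X T ω) ^ 2 ∂μ = ∫ ω, f T * B T ω ^ 2 ∂μ +
      2 * ∫ ω, f T * B T ω * X T ω ∂μ + ∫ ω, f T * X T ω ^ 2 ∂μ := by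
    simp only [hsplit]
    exact integral_add_two_mul_add hj1 hj2 hj3
  have hR : ∫ z, (f' z.1 * (B z.1 z.2 + X z.1 z.2) ^ 2 -
      2 * f z.1 * (B z.1 z.2 + X z.1 z.2) * nu z.1 z.2) ∂P =
      ∫ z, (f' z.1 * B z.1 z.2 ^ 2 - 2 * f z.1 * B z.1 z.2 * nu z.1 z.2) ∂P +
      2 * ∫ z, (f' z.1 * B z.1 z.2 - f z.1 * nu z.1 z.2) * X z.1 z.2 ∂P +
      ∫ z, f' z.1 * X z.1 z.2 ^ 2 ∂P := by
    rw [← integral_add_two_mul_add hi1 hi3 hi4]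
    refine integral_congr_ae (Filter.Eventually.of_forall fun z => ?_)
    ring
  rw [hL, hR, hE1, hE2, hE3]
  ring

/-! ### The Riccati equation and its explicit solution -/

namespace Params

variable {p : Params}

theorem rate_pos (hk : 0 < p.k) (hphi : 0 < p.phi) : 0 < p.rate := Real.sqrt_pos.2 (div_pos hphi hk)

theorem k_mul_rate_sq (hk : 0 < p.k) (hphi : 0 < p.phi) : p.k * p.rate ^ 2 = p.phi := by
  rw [rate, Real.sq_sqrt (div_pos hphi hk).le]
  field_simp

/-- This keeps every denominator in the explicit formulas away from zero up to time `T`. -/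
theorem one_lt_xi_mul_exp (hk : 0 < p.k) (hphi : 0 < p.phi) (hxi : 1 < p.xi) {s T : ℝ}
    (hs : s ≤ T) : 1 < p.xi * Real.exp (2 * p.rate * (T - s)) := by
  have h1 : 1 ≤ Real.exp (2 * p.rate * (T - s)) := Real.one_le_exp
    (mul_nonneg (mul_nonneg zero_le_two (rate_pos hk hphi).le) (sub_nonneg.2 hs))
  nlinarith

theorem h2_terminal (hk : 0 < p.k) (hphi : 0 < p.phi) (hxi : 1 < p.xi) (T : ℝ) :
    p.h2 T T = -p.alpha := by
  have hr := mul_pos hk (rate_pos hk hphi)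
  -- If this denominator vanished, ξ would be 0 by the convention x / 0 = 0, contradicting ξ > 1.
  have hd : p.alpha - p.b / 2 - p.k * p.rate ≠ 0 := fun h => by
    rw [xi, h, div_zero] at hxi
    linarith
  have hx : 1 - p.xi ≠ 0 := by linarith
  have e : p.xi * (p.alpha - p.b / 2 - p.k * p.rate) = p.alpha - p.b / 2 + p.k * p.rate := by
    rw [xi, div_mul_cancel₀ _ hd]
  rw [h2, sub_self, mul_zero, Real.exp_zero, mul_one]
  have : p.k * p.rate * ((1 + p.xi) / (1 - p.xi)) = -p.alpha + p.b / 2 := by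
    rw [← mul_div_assoc, div_eq_iff hx]
    linear_combination -e
  linarith

/-- This is the q² coefficient of the Hamilton–Jacobi–Bellman equation: maximising -kν² - (b +
2h₂)qν over ν gives (b + 2h₂)²q²/(4k). -/
theorem hasDerivAt_h2 (hk : 0 < p.k) (hphi : 0 < p.phi) (hxi : 1 < p.xi) {s T : ℝ} (hs : s ≤ T) :
    HasDerivAt (p.h2 T) (p.phi - (p.b + 2 * p.h2 T s) ^ 2 / (4 * p.k)) s := by
  have h1 := one_lt_xi_mul_exp hk hphi hxi hs
  have hd : 1 - p.xi * Real.exp (2 * p.rate * (T - s)) ≠ 0 := by linarith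
  have hE : HasDerivAt (fun s => p.xi * Real.exp (2 * p.rate * (T - s)))
      (p.xi * (Real.exp (2 * p.rate * (T - s)) * (2 * p.rate * -1))) s :=
    ((((hasDerivAt_id s).const_sub T).const_mul (2 * p.rate)).exp).const_mul p.xi
  have h := (((hE.const_add 1).div (hE.const_sub 1) hd).const_mul (p.k * p.rate)).sub_const (p.b / 2)
  refine h.congr_deriv ?_
  rw [← k_mul_rate_sq hk hphi, h2]
  set E := p.xi * Real.exp (2 * p.rate * (T - s))
  have hEE : p.xi * (Real.exp (2 * p.rate * (T - s)) * (2 * p.rate * -1)) = -(2 * p.rate * E) := by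
    simp only [E]; ring
  rw [hEE]
  field_simp
  ring

theorem continuousOn_h2 (hk : 0 < p.k) (hphi : 0 < p.phi) (hxi : 1 < p.xi) (t T : ℝ) :
    ContinuousOn (p.h2 T) (Icc t T) := fun _ hs =>
  (hasDerivAt_h2 hk hphi hxi hs.2).continuousAt.continuousWithinAt

theorem contDiffOn_h2 (hk : 0 < p.k) (hphi : 0 < p.phi) (hxi : 1 < p.xi) (t T : ℝ) :
    ContDiffOn ℝ 1 (p.h2 T) (Icc t T) := by
  have hE : ContDiff ℝ 1 fun s => p.xi * Real.exp (2 * p.rate * (T - s)) := by fun_prop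
  refine ((contDiff_const.contDiffOn).mul ((contDiff_const.add hE).contDiffOn.div
    (contDiff_const.sub hE).contDiffOn fun s hs => ?_)).sub contDiff_const.contDiffOn
  have := one_lt_xi_mul_exp hk hphi hxi hs.2
  linarith

/-- In this form the feedback is visibly the maximiser of -kν² - (b + 2h₂)qν. -/
theorem feedback_eq (hk : 0 < p.k) (hphi : 0 < p.phi) (hxi : 1 < p.xi) {s T : ℝ} (hs : s ≤ T)
    (q : ℝ) : p.feedback T s q = -((p.b + 2 * p.h2 T s) / (2 * p.k)) * q := by
  have h1 := one_lt_xi_mul_exp hk hphi hxi hs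
  rw [feedback, h2]
  set E := p.xi * Real.exp (2 * p.rate * (T - s))
  have hd : 1 - E ≠ 0 := by linarith
  have hd' : E - 1 ≠ 0 := by linarith
  have e : (E + 1) / (E - 1) = -((1 + E) / (1 - E)) := by
    rw [← neg_sub 1 E, div_neg, add_comm]
  rw [e]
  field_simp
  ring

/-- `ξ e^{φ̃ (T - s)} - e^{-φ̃ (T - s)}`, the factor by which the optimal inventory shrinks. -/
noncomputable def discount (p : Params) (T s : ℝ) : ℝ :=
  p.xi * Real.exp (p.rate * (T - s)) - Real.exp (-(p.rate * (T - s)))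

theorem discount_eq (T s : ℝ) : p.discount T s =
    Real.exp (-(p.rate * (T - s))) * (p.xi * Real.exp (2 * p.rate * (T - s)) - 1) := by
  have e : Real.exp (p.rate * (T - s)) =
      Real.exp (-(p.rate * (T - s))) * Real.exp (2 * p.rate * (T - s)) := by
    rw [← Real.exp_add]; congr 1; ring
  rw [discount, e]
  ring

theorem discount_pos (hk : 0 < p.k) (hphi : 0 < p.phi) (hxi : 1 < p.xi) {s T : ℝ} (hs : s ≤ T) :
    0 < p.discount T s := by
  rw [discount_eq]
  exact mul_pos (Real.exp_pos _) (sub_pos.2 (one_lt_xi_mul_exp hk hphi hxi hs))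

/-- The factor solves the closed-loop equation without jumps. It serves as integrating factor for
the optimal inventory, and its logarithmic derivative gives h₀'. -/
theorem hasDerivAt_discount (hk : 0 < p.k) (hphi : 0 < p.phi) (hxi : 1 < p.xi) {s T : ℝ}
    (hs : s ≤ T) : HasDerivAt (p.discount T) (-p.feedback T s (p.discount T s)) s := by
  have h1 := one_lt_xi_mul_exp hk hphi hxi hs
  have hd' : p.xi * Real.exp (2 * p.rate * (T - s)) - 1 ≠ 0 := by linarith
  have hE : HasDerivAt (fun s => p.rate * (T - s)) (p.rate * -1) s :=
    ((hasDerivAt_id s).const_sub T).const_mul p.rate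
  have hE' : HasDerivAt (fun s => -(p.rate * (T - s))) (-(p.rate * -1)) s := hE.neg
  refine ((hE.exp.const_mul p.xi).sub hE'.exp).congr_deriv ?_
  have e : Real.exp (p.rate * (T - s)) =
      Real.exp (-(p.rate * (T - s))) * Real.exp (2 * p.rate * (T - s)) := by
    rw [← Real.exp_add]; congr 1; ring
  rw [feedback, discount_eq, e]
  generalize Real.exp (2 * p.rate * (T - s)) = E at *
  field_simp
  ring

theorem contDiff_discount (T : ℝ) : ContDiff ℝ 1 (p.discount T) := by
  unfold discount
  fun_prop

/-- The logarithm contributes 2λmk times the feedback coefficient, that is -λm(b + 2h₂), and the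
linear term of h₀ removes the part with b. -/
theorem hasDerivAt_h0 (hk : 0 < p.k) (hphi : 0 < p.phi) (hxi : 1 < p.xi) (m : ℝ) {s T : ℝ}
    (hs : s ≤ T) :
    HasDerivAt (p.h0 m T) (-(2 * p.lam * m * p.h2 T s + 2 * p.lam * p.eta * p.r * p.S0)) s := by
  have hg := discount_pos hk hphi hxi hs
  have hx : p.xi - 1 ≠ 0 := by linarith
  have h1 := ((((hasDerivAt_discount hk hphi hxi hs).fun_inv hg.ne').const_mul (p.xi - 1)).log
    (mul_ne_zero hx (inv_ne_zero hg.ne'))).const_mul (2 * p.lam * m * p.k)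
  have h2 := ((hasDerivAt_id s).sub_const T).const_mul
    (p.lam * m * p.b - 2 * p.r * p.lam * p.eta * p.S0)
  refine (h1.add h2).congr_deriv ?_
  rw [feedback_eq hk hphi hxi hs]
  field_simp
  ring

theorem h0_eq (hk : 0 < p.k) (hphi : 0 < p.phi) (hxi : 1 < p.xi) (m : ℝ) {t T : ℝ}
    (htT : t ≤ T) : p.h0 m T t = 2 * p.lam * m * (∫ s in Icc t T, p.h2 T s) +
      2 * p.lam * p.eta * p.r * p.S0 * (T - t) := by
  have hx : p.xi - 1 ≠ 0 := by linarith
  have hT : p.h0 m T T = 0 := by simp [h0, hx]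
  have hc : ContinuousOn (p.h2 T) (uIcc t T) := by
    rw [uIcc_of_le htT]; exact continuousOn_h2 hk hphi hxi t T
  have hint : IntervalIntegrable (p.h2 T) volume t T := hc.intervalIntegrable
  have h := intervalIntegral.integral_eq_sub_of_hasDerivAt (a := t) (b := T)
    (fun s hs => hasDerivAt_h0 (p := p) hk hphi hxi m (by rw [uIcc_of_le htT] at hs; exact hs.2))
    ((hint.const_mul _).add intervalIntegrable_const).neg
  rw [hT, intervalIntegral.integral_neg, intervalIntegral.integral_add (hint.const_mul _)
    intervalIntegrable_const, intervalIntegral.integral_const_mul,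
    intervalIntegral.integral_const, smul_eq_mul] at h
  rw [integral_Icc_eq_integral_Ioc, ← intervalIntegral.integral_of_le htT]
  linarith

end Params

/-! ### Completing the square in the expected reward -/

namespace Noise

section Controls

variable {Ω : Type*} [mΩ : MeasurableSpace Ω] {p : Params} {μ : Measure Ω} {M : Noise p μ}
  {t T : ℝ} {nu : ℝ → Ω → ℝ}

/-- An admissible control is constrained only on [t, T]. Clamping time to [t, s] extends it to the
whole line without using information after `s`. -/
theorem measurable_control_extend (hnu : nu ∈ M.admissible t T) {s : ℝ} (hs : s ∈ Icc t T) :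
    Measurable[(inferInstance : MeasurableSpace ℝ).prod (M.filtration s.toNNReal)]
      fun z : ℝ × Ω => nu (projIcc t s hs.1 z.1) z.2 := by
  have h := hnu.1 s hs
  have h1 : Measurable[(inferInstance : MeasurableSpace ℝ).prod (M.filtration s.toNNReal),
      (Subtype.instMeasurableSpace : MeasurableSpace (Icc t s)).prod (M.filtration s.toNNReal)]
      fun z : ℝ × Ω => (projIcc t s hs.1 z.1, z.2) :=
    Measurable.prodMk
      (continuous_projIcc.measurable.comp (@measurable_fst _ _ _ (M.filtration s.toNNReal)))
      (@measurable_snd _ _ _ (M.filtration s.toNNReal))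
  exact h.comp h1

theorem measurable_control_section (hnu : nu ∈ M.admissible t T) {s : ℝ} (hs : s ∈ Icc t T) :
    Measurable[M.filtration s.toNNReal] (nu s) := by
  have h := (measurable_control_extend hnu hs).comp
    (@measurable_prodMk_left _ _ _ (M.filtration s.toNNReal) s)
  simpa [Function.comp_def, projIcc_of_mem hs.1 (right_mem_Icc.2 hs.1)] using h

theorem measurable_drift (hnu : nu ∈ M.admissible t T) {s : ℝ} (hs : s ∈ Icc t T) (q : ℝ) :
    Measurable[M.filtration s.toNNReal] fun ω => q - ∫ u in t..s, nu u ω := by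
  have h := (@measurable_intervalIntegral_prod Ω (M.filtration s.toNNReal)
    (fun u ω => nu (projIcc t s hs.1 u) ω) (measurable_control_extend hnu hs) t).comp
    (@measurable_prodMk_left _ _ _ (M.filtration s.toNNReal) s)
  refine @Measurable.const_sub _ _ _ _ _ (_) _ ?_ q
  convert h using 2 with ω
  refine intervalIntegral.integral_congr fun u hu => ?_
  rw [uIcc_of_le hs.1] at hu
  simp only [projIcc_of_mem hs.1 hu]

theorem inventory_congr {nu' : ℝ → Ω → ℝ} (h : ∀ s ∈ Icc t T, ∀ ω, nu' s ω = nu s ω) (q : ℝ)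
    {s : ℝ} (hs : s ∈ Icc t T) (ω : Ω) : M.inventory t q nu' s ω = M.inventory t q nu s ω := by
  rw [inventory_eq, inventory_eq]
  congr 2
  refine intervalIntegral.integral_congr fun u hu => ?_
  rw [uIcc_of_le hs.1] at hu
  exact h u ⟨hu.1, hu.2.trans hs.2⟩ ω

theorem admissible_congr {nu' : ℝ → Ω → ℝ} (h : ∀ s ∈ Icc t T, ∀ ω, nu' s ω = nu s ω)
    (hnu : nu ∈ M.admissible t T) : nu' ∈ M.admissible t T := by
  refine ⟨fun s hs => ?_, ?_⟩
  · have e : (fun x : Icc t s × Ω => nu' x.1 x.2) = fun x : Icc t s × Ω => nu x.1 x.2 := by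
      funext x
      exact h _ ⟨x.1.2.1, x.1.2.2.trans hs.2⟩ _
    rw [e]
    exact hnu.1 s hs
  · have e : ∀ ω, ∫⁻ s in Icc t T, ‖nu' s ω‖ₑ ^ 2 = ∫⁻ s in Icc t T, ‖nu s ω‖ₑ ^ 2 := fun ω =>
      setLIntegral_congr_fun measurableSet_Icc fun s hs => by rw [h s hs ω]
    simpa only [e] using hnu.2

theorem reward_congr {nu' : ℝ → Ω → ℝ} (htT : t ≤ T) (h : ∀ s ∈ Icc t T, ∀ ω, nu' s ω = nu s ω)
    (q : ℝ) : M.reward t T q nu' = M.reward t T q nu := by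
  refine integral_congr_ae (Filter.Eventually.of_forall fun ω => ?_)
  simp only
  rw [inventory_congr h q (right_mem_Icc.2 htT)]
  congr 1
  refine intervalIntegral.integral_congr fun s hs => ?_
  rw [uIcc_of_le htT] at hs
  simp only [inventory_congr h q hs, h s hs]

theorem aestronglyMeasurable_netJumps [IsProbabilityMeasure μ] (htT : t ≤ T) :
    AEStronglyMeasurable (Function.uncurry (M.netJumps t))
      ((volume.restrict (Icc t T)).prod μ) := by
  have h := (M.measurable_netJumps_comp htT (τ := fun a : ℝ => min a T)
    (measurable_id.min measurable_const) fun a => min_le_right _ _).mono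
    (sup_le_sup_left (MeasurableSpace.comap_mono (M.filtration.le _)) _) le_rfl
  refine h.aestronglyMeasurable.congr ?_
  filter_upwards [ae_mem_Icc_prod] with z hz
  rw [min_eq_left hz.2]
  rfl

theorem memLp_inventory [IsProbabilityMeasure μ] (htT : t ≤ T)
    (hnu : Measurable (Function.uncurry nu))
    (h2 : MemLp (Function.uncurry nu) 2 ((volume.restrict (Icc t T)).prod μ)) (q : ℝ) :
    MemLp (fun z : ℝ × Ω => M.inventory t q nu z.1 z.2) 2
      ((volume.restrict (Icc t T)).prod μ) := by
  simp only [inventory_eq]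
  exact (memLp_sub_integral_prod htT hnu h2 q).add (memLp_of_dominated
    (aestronglyMeasurable_netJumps htT) (fun s hs ω => M.abs_netJumps_le hs.2 ω)
    (M.memLp_totalJumps htT))

theorem integrable_runningReward [IsProbabilityMeasure μ] {Q N : ℝ × Ω → ℝ}
    (hQ : MemLp Q 2 ((volume.restrict (Icc t T)).prod μ))
    (hN : MemLp N 2 ((volume.restrict (Icc t T)).prod μ)) :
    Integrable (fun z => p.runningReward (Q z) (N z)) ((volume.restrict (Icc t T)).prod μ) := by
  have h := (((hN.integrable_sq.const_mul (-p.k)).sub ((hN.integrable_mul hQ).const_mul p.b)).sub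
    (hQ.integrable_sq.const_mul p.phi)).add (integrable_const (2 * p.lam * p.eta * p.r * p.S0))
  refine h.congr (Filter.Eventually.of_forall fun z => ?_)
  simp only [Pi.add_apply, Pi.sub_apply, Pi.mul_apply, Params.runningReward]
  ring

/-- The expected reward is the explicit function minus the cost of deviating from the feedback. -/
theorem reward_eq_of_measurable [IsProbabilityMeasure μ] (hk : 0 < p.k) (hphi : 0 < p.phi)
    (hxi : 1 < p.xi) (ht : 0 ≤ t) (htT : t ≤ T) (q : ℝ) (hnu : nu ∈ M.admissible t T)
    (hm : Measurable (Function.uncurry nu)) :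
    Integrable (fun x : ℝ × Ω => p.runningReward (M.inventory t q nu x.1 x.2) (nu x.1 x.2))
        ((volume.restrict (Icc t T)).prod μ) ∧
      Integrable (fun ω => p.terminalReward (M.inventory t q nu T ω)) μ ∧
      M.reward t T q nu = p.explicitSolution M.secondMoment T t q -
        p.k * ∫ z, (nu z.1 z.2 - p.feedback T z.1 (M.inventory t q nu z.1 z.2)) ^ 2
          ∂(volume.restrict (Icc t T)).prod μ := by
  set P := (volume.restrict (Icc t T)).prod μ with hP
  have hTm : T ∈ Icc t T := right_mem_Icc.2 htT
  have hN : MemLp (fun z : ℝ × Ω => nu z.1 z.2) 2 P := memLp_control hm hnu.2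
  have hQ : MemLp (fun z : ℝ × Ω => M.inventory t q nu z.1 z.2) 2 P := memLp_inventory htT hm hN q
  have hX : ∀ s ∈ Icc t T, MemLp (M.netJumps t s) 2 μ := fun s hs => M.memLp_netJumps hs.1
  have hF : Integrable (fun z : ℝ × Ω =>
      p.runningReward (M.inventory t q nu z.1 z.2) (nu z.1 z.2)) P := integrable_runningReward hQ hN
  have hQT : MemLp (M.inventory t q nu T) 2 μ := by
    have e : M.inventory t q nu T = fun ω => q - (∫ u in t..T, nu u ω) + M.netJumps t T ω := by
      funext ω; exact M.inventory_eq t q nu T ω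
    rw [e]
    exact (memLp_sub_integral htT hm hN q hTm).add (hX T hTm)
  have hG : Integrable (fun ω => p.terminalReward (M.inventory t q nu T ω)) μ :=
    hQT.integrable_sq.const_mul _
  refine ⟨hF, hG, ?_⟩
  have horth : ∀ s ∈ Icc t T, ∀ Y : Ω → ℝ, Measurable[M.filtration s.toNNReal] Y → MemLp Y 2 μ →
      ∫ ω, Y ω * M.netJumps t T ω ∂μ = ∫ ω, Y ω * M.netJumps t s ω ∂μ := fun s hs Y hY hY2 => by
    rw [← sub_eq_zero]
    have h := M.integral_mul_netJumps hs.2 hY hY2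
    simp only [← M.netJumps_sub hs.1 hs.2, mul_sub] at h
    exact (integral_sub (hY2.integrable_mul (hX T hTm)) (hY2.integrable_mul (hX s hs))).symm.trans h
  -- Admissibility makes ν_s square integrable only for almost every s, which is all that the Dynkin
  -- formula asks.
  have hN2 : ∀ᵐ s ∂volume.restrict (Icc t T), Integrable (fun ω => nu s ω ^ 2) μ :=
    hN.integrable_sq.prod_right_ae
  have hf'c : ContinuousOn (fun s => p.phi - (p.b + 2 * p.h2 T s) ^ 2 / (4 * p.k)) (Icc t T) := by
    have := Params.continuousOn_h2 hk hphi hxi t T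
    fun_prop
  have key := integral_mul_sq_state (μ := μ) (nu := nu) (X := M.netJumps t) (f := p.h2 T)
    (f' := fun s => p.phi - (p.b + 2 * p.h2 T s) ^ 2 / (4 * p.k)) htT
    (Params.contDiffOn_h2 hk hphi hxi t T)
    (fun s hs => Params.hasDerivAt_h2 hk hphi hxi hs.2) hf'c hm hN
    (aestronglyMeasurable_netJumps htT) hX (fun s hs ω => M.abs_netJumps_le hs.2 ω)
    (M.memLp_totalJumps htT) (M.integral_netJumps htT)
    (fun s hs => M.integral_sq_netJumps ht hs.1) q
    (by
      filter_upwards [hN2, ae_restrict_mem measurableSet_Icc] with s h hs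
      have hs' := measurable_control_section hnu hs
      exact horth s hs _ hs' ((memLp_two_iff_integrable_sq
        (hs'.mono (M.filtration.le _) le_rfl).aestronglyMeasurable).2 h))
    (by
      filter_upwards [ae_restrict_mem measurableSet_Icc] with s hs
      exact horth s hs _ (measurable_drift hnu hs q) (memLp_sub_integral htT hm hN q hs))
  simp only [← M.inventory_eq] at key
  have hGe : ∫ ω, p.terminalReward (M.inventory t q nu T ω) ∂μ =
      ∫ ω, p.h2 T T * M.inventory t q nu T ω ^ 2 ∂μ := by
    simp only [Params.terminalReward, Params.h2_terminal hk hphi hxi]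
  have hR : M.reward t T q nu =
      ∫ z, p.runningReward (M.inventory t q nu z.1 z.2) (nu z.1 z.2) ∂P +
        ∫ ω, p.terminalReward (M.inventory t q nu T ω) ∂μ := by
    rw [integral_prod_symm _ hF, ← integral_add hF.integral_prod_right hG]
    simp only [reward, intervalIntegral.integral_of_le htT, integral_Icc_eq_integral_Ioc]
  -- The Riccati equation cancels the q² terms left after completing the square in ν.
  have hdev : ∀ᵐ z ∂P, p.runningReward (M.inventory t q nu z.1 z.2) (nu z.1 z.2) +
      ((p.phi - (p.b + 2 * p.h2 T z.1) ^ 2 / (4 * p.k)) * M.inventory t q nu z.1 z.2 ^ 2 -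
        2 * p.h2 T z.1 * M.inventory t q nu z.1 z.2 * nu z.1 z.2) =
      2 * p.lam * p.eta * p.r * p.S0 -
        p.k * (nu z.1 z.2 - p.feedback T z.1 (M.inventory t q nu z.1 z.2)) ^ 2 := by
    filter_upwards [ae_mem_Icc_prod] with z hz
    rw [Params.feedback_eq hk hphi hxi hz.2, Params.runningReward]
    field_simp
    ring
  have hi : Integrable (fun z : ℝ × Ω =>
      (p.phi - (p.b + 2 * p.h2 T z.1) ^ 2 / (4 * p.k)) * M.inventory t q nu z.1 z.2 ^ 2 -
        2 * p.h2 T z.1 * M.inventory t q nu z.1 z.2 * nu z.1 z.2) P := by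
    have h := ((memLp_mul_continuousOn hf'c hQ).integrable_mul hQ).sub
      (((memLp_mul_continuousOn (Params.continuousOn_h2 hk hphi hxi t T) hQ).integrable_mul
        hN).const_mul 2)
    refine h.congr (Filter.Eventually.of_forall fun z => ?_)
    simp only [Pi.sub_apply, Pi.mul_apply]
    ring
  have hfb : MemLp (fun z : ℝ × Ω => p.feedback T z.1 (M.inventory t q nu z.1 z.2)) 2 P := by
    have hc : ContinuousOn (fun s => -((p.b + 2 * p.h2 T s) / (2 * p.k))) (Icc t T) := by
      have := Params.continuousOn_h2 hk hphi hxi t T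
      fun_prop
    refine (memLp_congr_ae ?_).1 (memLp_mul_continuousOn hc hQ)
    filter_upwards [ae_mem_Icc_prod] with z hz
    rw [Params.feedback_eq hk hphi hxi hz.2]
  have hdi : Integrable (fun z : ℝ × Ω =>
      p.k * (nu z.1 z.2 - p.feedback T z.1 (M.inventory t q nu z.1 z.2)) ^ 2) P :=
    (hN.sub hfb).integrable_sq.const_mul p.k
  have hsum := integral_congr_ae hdev
  rw [integral_add hF hi, integral_sub (integrable_const _) hdi, integral_const,
    integral_const_mul] at hsum
  -- The total mass of P turns the constant running reward into the linear part of h₀; `h0_eq`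
  -- supplies the rest as the integral of h₂.
  have hvol : P.real univ = T - t := by
    rw [hP, measureReal_def, ← univ_prod_univ, Measure.prod_prod]
    simp [htT]
  rw [hvol, smul_eq_mul] at hsum
  rw [hR, hGe, key, Params.explicitSolution, Params.h0_eq hk hphi hxi _ htT]
  linear_combination hsum

end Controls

end Noise

/-! ### The closed-loop equation along a given jump path -/

namespace Params

variable {p : Params}

theorem feedback_eq_mul (T s q : ℝ) : p.feedback T s q = p.feedback T s 1 * q := by
  simp only [feedback, mul_one]

theorem continuousOn_feedback (hk : 0 < p.k) (hphi : 0 < p.phi) (hxi : 1 < p.xi) (t T : ℝ) :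
    ContinuousOn (fun s => p.feedback T s 1) (Icc t T) := by
  have h := continuousOn_h2 hk hphi hxi t T
  have hc : ContinuousOn (fun s => -((p.b + 2 * p.h2 T s) / (2 * p.k)) * 1) (Icc t T) := by
    fun_prop
  exact hc.congr fun s hs => feedback_eq hk hphi hxi hs.2 1

/-- The drift part of the optimally controlled inventory, given the path `x` of the net jumps. -/
noncomputable def optimalDrift (p : Params) (t T q : ℝ) (x : ℝ → ℝ) (s : ℝ) : ℝ :=
  p.discount T s * (q / p.discount T t - ∫ u in t..s, p.feedback T u 1 / p.discount T u * x u)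

theorem continuousOn_ratio (hk : 0 < p.k) (hphi : 0 < p.phi) (hxi : 1 < p.xi) (t T : ℝ) :
    ContinuousOn (fun u => p.feedback T u 1 / p.discount T u) (Icc t T) :=
  (continuousOn_feedback hk hphi hxi t T).div (contDiff_discount T).continuous.continuousOn
    fun _ hs => (discount_pos hk hphi hxi hs.2).ne'

/-- Variation of constants: with g the discount and f the feedback coefficient, g' = -f g, so B =
g(q/g(t) - ∫(f/g)x) satisfies B' = -f(B + x) almost everywhere. The path x enters under the integral
only, so its jumps do no harm. -/
theorem integral_feedback_optimalDrift (hk : 0 < p.k) (hphi : 0 < p.phi) (hxi : 1 < p.xi)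
    {t T : ℝ} (q : ℝ) {x : ℝ → ℝ} (hx : IntegrableOn x (Icc t T)) {s : ℝ} (hs : s ∈ Icc t T) :
    q - ∫ u in t..s, p.feedback T u (p.optimalDrift t T q x u + x u) =
      p.optimalDrift t T q x s := by
  have hsub : Icc t s ⊆ Icc t T := Icc_subset_Icc_right hs.2
  have hv : IntervalIntegrable (fun u => p.feedback T u 1 / p.discount T u * x u) volume t s := by
    rw [intervalIntegrable_iff_integrableOn_Icc_of_le hs.1]
    exact (hx.mono_set hsub).continuousOn_mul
      ((continuousOn_ratio hk hphi hxi t T).mono hsub) isCompact_Icc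
  have h := integral_eq_sub_of_absolutelyContinuous
    (F' := fun u => -p.feedback T u (p.optimalDrift t T q x u + x u))
    ((contDiff_discount (p := p) T).contDiffOn.absolutelyContinuousOnInterval.fun_mul
      (absolutelyContinuous_sub_integral hv (q / p.discount T t))) (by
      filter_upwards [ae_hasDerivAt_sub_integral hv (q / p.discount T t)] with u hu hum
      have hum' := hum
      rw [uIcc_of_le hs.1] at hum'
      have hg := (discount_pos hk hphi hxi (hum'.2.trans hs.2)).ne'
      refine ((hasDerivAt_discount hk hphi hxi (hum'.2.trans hs.2)).mul (hu hum)).congr_deriv ?_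
      rw [feedback_eq_mul T u (p.discount T u), feedback_eq_mul T u (_ + _), optimalDrift]
      field_simp
      ring)
  rw [intervalIntegral.integral_neg] at h
  have hgt := (discount_pos hk hphi hxi (hs.1.trans hs.2)).ne'
  simp only [intervalIntegral.integral_same, sub_zero, mul_div_cancel₀ q hgt] at h
  rw [optimalDrift]
  linarith

/-- The constants do not depend on the path, so a square integrable bound on the jumps gives a
square integrable bound on the control. -/
theorem exists_bound_feedback_optimalDrift (hk : 0 < p.k) (hphi : 0 < p.phi) (hxi : 1 < p.xi)
    (t T q : ℝ) : ∃ C₀ C₁ : ℝ, ∀ (x : ℝ → ℝ) (d : ℝ), 0 ≤ d → (∀ s ∈ Icc t T, |x s| ≤ d) →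
      ∀ s ∈ Icc t T, |p.feedback T s (p.optimalDrift t T q x s + x s)| ≤ C₀ + C₁ * d := by
  obtain ⟨Cf, hCf⟩ := isCompact_Icc.exists_bound_of_continuousOn
    (continuousOn_feedback hk hphi hxi t T)
  obtain ⟨Cr, hCr⟩ := isCompact_Icc.exists_bound_of_continuousOn
    (continuousOn_ratio hk hphi hxi t T)
  obtain ⟨Cg, hCg⟩ := isCompact_Icc.exists_bound_of_continuousOn
    ((contDiff_discount (p := p) T).continuous.continuousOn (s := Icc t T))
  simp only [Real.norm_eq_abs] at hCf hCr hCg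
  refine ⟨Cf * (Cg * |q / p.discount T t|), Cf * (Cg * (Cr * (T - t)) + 1), ?_⟩
  intro x d hd hx s hs
  have hCf0 : 0 ≤ Cf := (abs_nonneg _).trans (hCf s hs)
  have hCg0 : 0 ≤ Cg := (abs_nonneg _).trans (hCg s hs)
  have hCr0 : 0 ≤ Cr := (abs_nonneg _).trans (hCr s hs)
  have hI : |∫ u in t..s, p.feedback T u 1 / p.discount T u * x u| ≤ Cr * d * (T - t) := by
    have h := intervalIntegral.norm_integral_le_of_norm_le_const (a := t) (b := s)
      (f := fun u => p.feedback T u 1 / p.discount T u * x u) (C := Cr * d) fun u hu => by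
        rw [uIoc_of_le hs.1] at hu
        have hu' : u ∈ Icc t T := ⟨hu.1.le, hu.2.trans hs.2⟩
        rw [norm_mul]
        exact mul_le_mul (hCr u hu') (hx u hu') (norm_nonneg _) hCr0
    rw [Real.norm_eq_abs, abs_of_nonneg (sub_nonneg.2 hs.1)] at h
    refine h.trans (mul_le_mul_of_nonneg_left ?_ (mul_nonneg hCr0 hd))
    linarith [hs.2]
  have hB : |p.optimalDrift t T q x s| ≤ Cg * (|q / p.discount T t| + Cr * d * (T - t)) := by
    rw [optimalDrift, abs_mul]
    exact mul_le_mul (hCg s hs) ((abs_sub _ _).trans (add_le_add_right hI _)) (abs_nonneg _) hCg0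
  rw [feedback_eq_mul, abs_mul]
  calc |p.feedback T s 1| * |p.optimalDrift t T q x s + x s|
      ≤ Cf * (Cg * (|q / p.discount T t| + Cr * d * (T - t)) + d) :=
        mul_le_mul (hCf s hs) ((abs_add_le _ _).trans (add_le_add hB (hx s hs)))
          (abs_nonneg _) hCf0
    _ = _ := by ring

theorem measurable_feedback (p : Params) (T : ℝ) : Measurable fun s => p.feedback T s 1 := by
  unfold feedback
  fun_prop

end Params

/-! ### Admissibility and optimality of the feedback control -/

namespace Noise

variable {Ω : Type*} [mΩ : MeasurableSpace Ω] {p : Params} {μ : Measure Ω} (M : Noise p μ)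

/-- The control obtained by following the linear feedback from the inventory `q` at time `t`. -/
noncomputable def optimalControl (t T q s : ℝ) (ω : Ω) : ℝ :=
  p.feedback T s (p.optimalDrift t T q (fun u => M.netJumps t u ω) s + M.netJumps t s ω)

theorem measurable_netJumps_path {t T : ℝ} (htT : t ≤ T) (ω : Ω) :
    Measurable fun u => M.netJumps t (min u T) ω :=
  (M.measurable_netJumps_comp htT (τ := fun a : ℝ => min a T)
    (measurable_id.min measurable_const) fun _ => min_le_right _ _).comp
    (@measurable_prodMk_right _ _ _ (M.filtration T.toNNReal) ω)

theorem integrableOn_netJumps_path {t T : ℝ} (htT : t ≤ T) (ω : Ω) :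
    IntegrableOn (fun u => M.netJumps t u ω) (Icc t T) := by
  have h : IntegrableOn (fun u => M.netJumps t (min u T) ω) (Icc t T) :=
    Measure.integrableOn_of_bounded (M := M.totalJumps t T ω) (by simp)
      (M.measurable_netJumps_path htT ω).aestronglyMeasurable
      (Filter.Eventually.of_forall fun u => M.abs_netJumps_le (min_le_right u T) ω)
  refine h.congr_fun (fun u hu => ?_) measurableSet_Icc
  simp only [min_eq_left hu.2]

theorem optimalControl_eq_feedback (hk : 0 < p.k) (hphi : 0 < p.phi) (hxi : 1 < p.xi)
    {t T : ℝ} (q : ℝ) {s : ℝ} (hs : s ∈ Icc t T) (ω : Ω) :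
    M.optimalControl t T q s ω =
      p.feedback T s (M.inventory t q (M.optimalControl t T q) s ω) := by
  rw [inventory_eq]
  simp only [optimalControl]
  rw [Params.integral_feedback_optimalDrift hk hphi hxi q
    (M.integrableOn_netJumps_path (hs.1.trans hs.2) ω) hs]

theorem optimalControl_mem_admissible [IsProbabilityMeasure μ] (hk : 0 < p.k) (hphi : 0 < p.phi)
    (hxi : 1 < p.xi) {t T : ℝ} (htT : t ≤ T) (q : ℝ) :
    M.optimalControl t T q ∈ M.admissible t T := by
  constructor
  · intro s hs
    -- Stopping the jump path at s changes nothing on [t, s] and makes it 𝓕_s-measurable jointly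
    -- with time on the whole line.
    have hX : Measurable[(inferInstance : MeasurableSpace ℝ).prod (M.filtration s.toNNReal)]
        fun z : ℝ × Ω => M.netJumps t (min z.1 s) z.2 :=
      M.measurable_netJumps_comp hs.1 (τ := fun a : ℝ => min a s)
        (measurable_id.min measurable_const) fun a => min_le_right _ _
    have hV : Measurable[(inferInstance : MeasurableSpace ℝ).prod (M.filtration s.toNNReal)]
        fun z : ℝ × Ω => p.feedback T z.1 1 / p.discount T z.1 * M.netJumps t (min z.1 s) z.2 :=
      Measurable.mul ((((p.measurable_feedback T).div
        (Params.contDiff_discount T).continuous.measurable)).comp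
          (@measurable_fst _ _ _ (M.filtration s.toNNReal))) hX
    have hI := @measurable_intervalIntegral_prod Ω (M.filtration s.toNNReal)
      (fun u ω => p.feedback T u 1 / p.discount T u * M.netJumps t (min u s) ω) hV t
    have hfst := @measurable_fst ℝ Ω (inferInstance : MeasurableSpace ℝ) (M.filtration s.toNNReal)
    have hB : Measurable[(inferInstance : MeasurableSpace ℝ).prod (M.filtration s.toNNReal)]
        fun z : ℝ × Ω => p.feedback T z.1 1 * (p.discount T z.1 * (q / p.discount T t -
          ∫ u in t..z.1, p.feedback T u 1 / p.discount T u * M.netJumps t (min u s) z.2) +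
          M.netJumps t (min z.1 s) z.2) :=
      Measurable.mul ((p.measurable_feedback T).comp hfst) (Measurable.add (Measurable.mul
        ((Params.contDiff_discount T).continuous.measurable.comp hfst)
          (Measurable.const_sub hI _)) hX)
    have hmap : Measurable[(Subtype.instMeasurableSpace : MeasurableSpace (Icc t s)).prod
        (M.filtration s.toNNReal), (inferInstance : MeasurableSpace ℝ).prod
        (M.filtration s.toNNReal)] fun x : Icc t s × Ω => ((x.1 : ℝ), x.2) :=
      Measurable.prodMk
        (measurable_subtype_coe.comp (@measurable_fst _ _ _ (M.filtration s.toNNReal)))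
        (@measurable_snd _ _ _ (M.filtration s.toNNReal))
    convert hB.comp hmap using 1
    funext x
    have hx := x.1.2
    simp only [optimalControl, Function.comp, min_eq_left hx.2]
    rw [Params.feedback_eq_mul, Params.optimalDrift]
    congr 4
    refine intervalIntegral.integral_congr fun u hu => ?_
    rw [uIcc_of_le hx.1] at hu
    simp only [min_eq_left (hu.2.trans hx.2)]
  · obtain ⟨C₀, C₁, hC⟩ := Params.exists_bound_feedback_optimalDrift hk hphi hxi t T q
    have hh : MemLp (fun ω => C₀ + C₁ * M.totalJumps t T ω) 2 μ :=
      (memLp_const C₀).add ((M.memLp_totalJumps htT).const_mul C₁)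
    have hlt : ∫⁻ ω, ‖C₀ + C₁ * M.totalJumps t T ω‖ₑ ^ 2 ∂μ < ∞ := by
      have := (eLpNorm_lt_top_iff_lintegral_rpow_enorm_lt_top two_ne_zero
        ENNReal.ofNat_ne_top).1 hh.2
      simpa using this
    calc ∫⁻ ω, (∫⁻ s in Icc t T, ‖M.optimalControl t T q s ω‖ₑ ^ 2) ∂μ
        ≤ ∫⁻ ω, (∫⁻ _s in Icc t T, ‖C₀ + C₁ * M.totalJumps t T ω‖ₑ ^ 2) ∂μ := by
          refine lintegral_mono fun ω => setLIntegral_mono' measurableSet_Icc fun s hs => ?_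
          refine pow_le_pow_left' (enorm_le_iff_norm_le.2 ?_) 2
          exact (hC _ _ (M.totalJumps_nonneg t T ω)
            (fun u hu => M.abs_netJumps_le hu.2 ω) s hs).trans (le_abs_self _)
      _ = volume (Icc t T) * ∫⁻ ω, ‖C₀ + C₁ * M.totalJumps t T ω‖ₑ ^ 2 ∂μ := by
          simp only [setLIntegral_const]
          rw [lintegral_mul_const' _ _ (by simp), mul_comm]
      _ < ∞ := ENNReal.mul_lt_top (by simp) hlt

/-- The expected reward of an admissible control. -/
theorem reward_eq [IsProbabilityMeasure μ] (hk : 0 < p.k) (hphi : 0 < p.phi)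
    (hxi : 1 < p.xi) {t T : ℝ} (ht : 0 ≤ t) (htT : t ≤ T) (q : ℝ) {nu : ℝ → Ω → ℝ}
    (hnu : nu ∈ M.admissible t T) :
    Integrable (fun x : ℝ × Ω => p.runningReward (M.inventory t q nu x.1 x.2) (nu x.1 x.2))
        ((volume.restrict (Icc t T)).prod μ) ∧
      Integrable (fun ω => p.terminalReward (M.inventory t q nu T ω)) μ ∧
      M.reward t T q nu = p.explicitSolution M.secondMoment T t q -
        p.k * ∫ z, (nu z.1 z.2 - p.feedback T z.1 (M.inventory t q nu z.1 z.2)) ^ 2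
          ∂(volume.restrict (Icc t T)).prod μ := by
  have hTm : T ∈ Icc t T := right_mem_Icc.2 htT
  -- Clamping makes the control jointly measurable; inventory and reward see only [t, T], so they do
  -- not change.
  let nu' : ℝ → Ω → ℝ := fun s ω => nu (projIcc t T htT s) ω
  have he : ∀ s ∈ Icc t T, ∀ ω, nu' s ω = nu s ω := fun s hs ω => by
    simp only [nu', projIcc_of_mem htT hs]
  have hm : Measurable (Function.uncurry nu') := (measurable_control_extend hnu hTm).mono
    (sup_le_sup_left (MeasurableSpace.comap_mono (M.filtration.le _)) _) le_rfl
  obtain ⟨h1, h2, h3⟩ := reward_eq_of_measurable hk hphi hxi ht htT q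
    (admissible_congr he hnu) hm
  refine ⟨h1.congr ?_, ?_, ?_⟩
  · filter_upwards [ae_mem_Icc_prod] with z hz
    rw [inventory_congr he q hz, he z.1 hz]
  · simpa only [inventory_congr he q hTm] using h2
  · rw [← reward_congr htT he q, h3]
    congr 2
    refine integral_congr_ae ?_
    filter_upwards [ae_mem_Icc_prod] with z hz
    rw [inventory_congr he q hz, he z.1 hz]

end Noise

end Liquidation

theorem mainTheorem3 {Ω : Type*} [MeasurableSpace Ω] (μ : Measure Ω) [IsProbabilityMeasure μ]
    (p : Liquidation.Params) (M : Liquidation.Noise p μ)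
    (hk : 0 < p.k) (hb : 0 ≤ p.b) (hphi : 0 < p.phi) (hxi : 1 < p.xi)
    (t T q : ℝ) (ht : 0 ≤ t) (htT : t ≤ T) :
    -- the expected reward is well defined for every admissible control
    (∀ nu ∈ M.admissible t T,
      Integrable (fun x : ℝ × Ω => p.runningReward (M.inventory t q nu x.1 x.2) (nu x.1 x.2))
          ((volume.restrict (Icc t T)).prod μ) ∧
        Integrable (fun ω => p.terminalReward (M.inventory t q nu T ω)) μ) ∧
    -- the explicit function is the value function
    M.value t T q = (p.explicitSolution M.secondMoment T t q : EReal) ∧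
    -- the optimum is attained by an admissible control given by the linear feedback
    (∃ nu ∈ M.admissible t T,
      (∀ s ∈ Icc t T, ∀ ω, nu s ω = p.feedback T s (M.inventory t q nu s ω)) ∧
        (M.reward t T q nu : EReal) = M.value t T q) := by
  have hfb : ∀ s ∈ Icc t T, ∀ ω, M.optimalControl t T q s ω =
      p.feedback T s (M.inventory t q (M.optimalControl t T q) s ω) := fun s hs ω =>
    M.optimalControl_eq_feedback hk hphi hxi q hs ω
  have hadm := M.optimalControl_mem_admissible hk hphi hxi htT q
  have hopt : M.reward t T q (M.optimalControl t T q) =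
      p.explicitSolution M.secondMoment T t q := by
    -- The control coincides with its own feedback on [t, T], so the deviation cost is zero.
    rw [(M.reward_eq hk hphi hxi ht htT q hadm).2.2, integral_eq_zero_of_ae, mul_zero, sub_zero]
    filter_upwards [Liquidation.ae_mem_Icc_prod] with z hz
    rw [← hfb z.1 hz z.2]
    simp
  have hval : M.value t T q = (p.explicitSolution M.secondMoment T t q : EReal) := by
    refine le_antisymm (iSup₂_le fun nu hnu => EReal.coe_le_coe_iff.2 ?_) ?_
    · rw [(M.reward_eq hk hphi hxi ht htT q hnu).2.2]
      exact sub_le_self _ (mul_nonneg hk.le (integral_nonneg fun z => sq_nonneg _))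
    · rw [← hopt]
      exact le_iSup₂ (f := fun nu (_ : nu ∈ M.admissible t T) => (M.reward t T q nu : EReal))
        _ hadm
  refine ⟨fun nu hnu => ?_, hval, M.optimalControl t T q, hadm, hfb, ?_⟩
  · obtain ⟨h1, h2, -⟩ := M.reward_eq hk hphi hxi ht htT q hnu
    exact ⟨h1, h2⟩
  · rw [hval, hopt]
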